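/- Let $\mathcal G_0$ be the set of right continuous nondecreasing maps $g:[0,1]\to[0,1]$, regarded as a subset of $L^2([0,1])$ (the value at the point $1$, which is irrelevant in $L^2$, is normalised to $g(1)=1$), with the metric $d^{L^2}$ induced from $L^2([0,1])$ and its Borel $\sigma$-algebra. For $N\ge 0$ let $$\Sigma_N=\{(x_1,\dots,x_N)\in[0,1]^N : 0=x_0<x_1<\dots<x_N<x_{N+1}=1\}.$$ For a partition $T=\{0=t_0<t_1<\dots<t_N<t_{N+1}=1\}$ of $[0,1]$ let $X(T)$ be the set $\Sigma_N$ with the metric $d^{T}(x,y)=\bigl(\sum_{i=1}^N |x_i-y_i|^2\,|t_{i+1}-t_i|\bigr)^{1/2}$, let $f^T:X(T)\to\mathcal G_0$, $f^T(x)=\sum_{i=1}^N x_i\chi_{(t_i,t_{i+1}]}$ (as an element of $L^2([0,1])$; its right continuous representative equals $x_i$ on $[t_i,t_{i+1})$), and for $\beta>0$ let $\mu_T$ be the measure on $X(T)$ given by $$\int_{X(T)}u\,d\mu_T=\frac{\Gamma(\beta)}{\prod_{i=0}^N\Gamma(\beta(t_{i+1}-t_i))}\int_{\Sigma_N}u(x_1,\dots,x_N)\prod_{i=0}^N(x_{i+1}-x_i)^{\beta(t_{i+1}-t_i)-1}\,dx_1\cdots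 dx_N .$$ Let $T_N^{\mathrm{std}}=\{k/2^N : 0\le k\le 2^N\}$ and write $(X_N^{\mathrm{std}},d^N)$, $f^N$, $\mu_N$ for the objects associated with $T_N^{\mathrm{std}}$. Proposition. Let $\beta>0$. Every $\mu_T$ is a probability measure. There is exactly one Borel probability measure $\mathbb Q^\beta_0$ on $\mathcal G_0$ such that for every partition $0=t_0<t_1<\dots<t_N<t_{N+1}=1$ and every bounded measurable function $u$ of $N$ real variables $$\int_{\mathcal G_0}u(g(t_1),\dots,g(t_N))\,d\mathbb Q^\beta_0(g)=\frac{\Gamma(\beta)}{\prod_{i=0}^N\Gamma(\beta(t_{i+1}-t_i))}\int_{\Sigma_N}u(x_1,\dots,x_N)\prod_{i=0}^N(x_{i+1}-x_i)^{\beta(t_{i+1}-t_i)-1}\,dx_1\cdots dx_N .$$ The push-forward measures $(f^N)_*\mu_N$ form a Cauchy sequence for the $2$-Wasserstein distance $d^W(\mu,\nu)=\bigl(\inf_\pi\int d^{L^2}(g,h)^2\,d\pi(g,h)\bigr)^{1/2}$ (infimum over the measures $\pi$ on $\mathcal G_0\times\mathcal G_0$ with marginals $\mu$ and $\nu$), and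 they converge to $\mathbb Q^\beta_0$ for $d^W$. Moreover $$(X_N^{\mathrm{std}},d^N,\mu_N)\longrightarrow(\mathcal G_0,d^{L^2},\mathbb Q^\beta_0)\qquad(N\to\infty)$$ in the measured Gromov–Hausdorff sense: there are $\varepsilon_N>0$ with $\varepsilon_N\to0$ and Borel maps $F_N:X_N^{\mathrm{std}}\to\mathcal G_0$ such that $|d^N(x,y)-d^{L^2}(F_N(x),F_N(y))|\le\varepsilon_N$ for all $x,y$, every point of $\mathcal G_0$ is within distance $\varepsilon_N$ of a point of $F_N(X_N^{\mathrm{std}})$, and $(F_N)_*\mu_N\to\mathbb Q^\beta_0$ weakly. -/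

import Mathlib

open MeasureTheory Filter Topology
open scoped unitInterval ENNReal BoundedContinuousFunction

noncomputable section

namespace EntropicMeasure

/-! ### The space of right continuous nondecreasing maps with the `L²` metric -/

/-- The space `𝒢₀` of right continuous nondecreasing maps `g : [0,1] → [0,1]`.
Elements of `𝒢₀` are regarded as elements of `L²([0,1])`, and the value at the single point `1`
(at which right continuity says nothing) is irrelevant there.  It is normalised to `g 1 = 1`, the
value taken at `1` by the inverse distribution functions `t ↦ inf {s | μ [0,s] > t}`,
`inf ∅ = 1`, so that every `L²`-class has exactly one representative. -/
@[ext]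
structure G0 where
  /-- The underlying map `[0,1] → [0,1]`. -/
  toFun : I → I
  monotone' : Monotone toFun
  rightCts' : ∀ t, ContinuousWithinAt toFun (Set.Ici t) t
  map_one' : toFun 1 = 1

namespace G0

instance : CoeFun G0 (fun _ => I → I) := ⟨G0.toFun⟩

theorem measurable (g : G0) : Measurable (fun s : I => ((g s : I) : ℝ)) :=
  measurable_subtype_coe.comp g.monotone'.measurable

theorem memLp (g : G0) : MemLp (fun s : I => ((g s : I) : ℝ)) 2 (volume : Measure I) := by
  refine MemLp.of_bound g.measurable.aestronglyMeasurable 1 (Eventually.of_forall fun s => ?_)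
  rw [Real.norm_eq_abs, abs_of_nonneg (g s).2.1]
  exact (g s).2.2

/-- The class of `g` in `L²([0,1])`. -/
def toL2 (g : G0) : Lp ℝ 2 (volume : Measure I) := g.memLp.toLp _

theorem toL2_injective : Function.Injective toL2 := by
  intro g h hgh
  have hae : (fun s : I => ((g s : I) : ℝ)) =ᵐ[volume] fun s : I => ((h s : I) : ℝ) :=
    (MemLp.toLp_eq_toLp_iff g.memLp h.memLp).1 hgh
  ext1
  funext t
  rcases eq_or_lt_of_le (show t ≤ 1 from t.2.2) with rfl | ht
  · rw [g.map_one', h.map_one']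
  by_contra hne
  have hopen : {p : I × I | p.1 ≠ p.2} ∈ 𝓝 (g.toFun t, h.toFun t) :=
    (isClosed_diagonal.isOpen_compl).mem_nhds hne
  have hev : ∀ᶠ s in 𝓝[≥] t, g.toFun s ≠ h.toFun s :=
    ((g.rightCts' t).prodMk_nhds (h.rightCts' t)).eventually hopen
  obtain ⟨b, hb, hsub⟩ := (mem_nhdsGE_iff_exists_Ico_subset' ht).1 hev
  have hzero : volume (Set.Ico t b) = 0 := by
    refine measure_mono_null (fun s hs => ?_) (ae_iff.1 hae)
    exact fun hc => hsub hs (Subtype.ext hc)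
  rw [unitInterval.volume_Ico, ENNReal.ofReal_eq_zero] at hzero
  have : (t : ℝ) < b := Subtype.coe_lt_coe.2 hb
  linarith

/-- The metric `d^{L²}` induced on `𝒢₀` from `L²([0,1])`. -/
instance : MetricSpace G0 := MetricSpace.induced toL2 toL2_injective inferInstance

/-- `𝒢₀` carries its Borel `σ`-algebra. -/
instance : MeasurableSpace G0 := borel G0

instance : BorelSpace G0 := ⟨rfl⟩

theorem dist_sq (g h : G0) : dist g h ^ 2 = ∫ s : I, ((g s : ℝ) - (h s : ℝ)) ^ 2 := by
  change dist (toL2 g) (toL2 h) ^ 2 = _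
  rw [dist_eq_norm, ← real_inner_self_eq_norm_sq, L2.inner_def]
  refine integral_congr_ae ?_
  filter_upwards [Lp.coeFn_sub (toL2 g) (toL2 h), g.memLp.coeFn_toLp, h.memLp.coeFn_toLp]
    with s h1 h2 h3
  have e1 : (toL2 g : I → ℝ) s = (g s : ℝ) := h2
  have e2 : (toL2 h : I → ℝ) s = (h s : ℝ) := h3
  rw [h1, Pi.sub_apply, e1, e2, real_inner_self_eq_norm_sq, Real.norm_eq_abs, sq_abs]

end G0

/-! ### Partitions and the associated finite dimensional spaces -/

/-- A partition `0 = t₀ < t₁ < ⋯ < t_N < t_{N+1} = 1` of `[0,1]` with `N` interior points. -/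
structure Partition (N : ℕ) where
  /-- The points of the partition. -/
  t : Fin (N + 2) → I
  t_zero : t 0 = 0
  t_last : t (Fin.last (N + 1)) = 1
  strictMono : StrictMono t

namespace Partition

variable {N : ℕ} (T : Partition N)

/-- The gap `t_{i+1} - t_i`, for `0 ≤ i ≤ N`. -/
def gap (i : Fin (N + 1)) : ℝ := (T.t i.succ : ℝ) - (T.t i.castSucc : ℝ)

theorem gap_pos (i : Fin (N + 1)) : 0 < T.gap i :=
  sub_pos.2 (T.strictMono i.castSucc_lt_succ)

/-- The standard partition, by the multiples of `2^{-N}`. -/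
def std (N : ℕ) : Partition (2 ^ N - 1) where
  t i := ⟨(i : ℕ) / 2 ^ N, by positivity, by
    rw [div_le_one (by positivity)]
    have h1 : 1 ≤ 2 ^ N := Nat.one_le_two_pow
    have h2 : (i : ℕ) ≤ 2 ^ N := by have := i.2; omega
    exact_mod_cast h2⟩
  t_zero := by ext; simp
  t_last := by
    ext
    have h1 : 1 ≤ 2 ^ N := Nat.one_le_two_pow
    simp [Nat.sub_add_cancel h1]
  strictMono i j hij := by
    have h : (i : ℕ) < j := hij
    rw [← Subtype.coe_lt_coe]
    dsimp only
    gcongr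

end Partition

/-- `(x₁,…,x_N)` with `x₀ = 0` and `x_{N+1} = 1` adjoined. -/
def extend {N : ℕ} (x : Fin N → ℝ) : Fin (N + 2) → ℝ :=
  Fin.cons 0 (Fin.snoc x 1 : Fin (N + 1) → ℝ)

/-- `Σ_N = {(x₁,…,x_N) | 0 = x₀ < x₁ < ⋯ < x_N < x_{N+1} = 1}`. -/
def Simplex (N : ℕ) : Set (Fin N → ℝ) := {x | StrictMono (extend x)}

/-- The increment `x_{i+1} - x_i`, for `0 ≤ i ≤ N`. -/
def increment {N : ℕ} (x : Fin N → ℝ) (i : Fin (N + 1)) : ℝ :=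
  extend x i.succ - extend x i.castSucc

theorem continuous_extend {N : ℕ} (i : Fin (N + 2)) :
    Continuous (fun x : Fin N → ℝ => extend x i) := by
  unfold extend
  refine Fin.cases ?_ (fun j => ?_) i
  · simpa using continuous_const
  · refine Fin.lastCases ?_ (fun k => ?_) j
    · simpa using continuous_const
    · simpa using continuous_apply k

theorem measurableSet_simplex (N : ℕ) : MeasurableSet (Simplex N) := by
  have : Simplex N = ⋂ (i : Fin (N + 2)) (j : Fin (N + 2)) (_ : i < j),
      {x | extend x i < extend x j} := by
    ext x
    simp [Simplex, StrictMono]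
  rw [this]
  exact MeasurableSet.iInter fun i => MeasurableSet.iInter fun j => MeasurableSet.iInter fun _ =>
    measurableSet_lt (continuous_extend i).measurable (continuous_extend j).measurable

/-- The set underlying the finite dimensional space `X({tᵢ})`: it is `Σ_N`.  The partition is an
argument because the metric depends on it. -/
@[ext]
structure PartitionSpace {N : ℕ} (T : Partition N) where
  /-- The coordinates `(x₁,…,x_N)`. -/
  val : Fin N → ℝ
  mem : val ∈ Simplex N

namespace PartitionSpace

variable {N : ℕ} {T : Partition N}

/-- The auxiliary homeomorphism `x ↦ ((t_{i+1} - tᵢ)^{1/2} xᵢ)ᵢ` of `ℝ^N` to Euclidean space. -/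
def scale (T : Partition N) : (Fin N → ℝ) ≃ₜ EuclideanSpace ℝ (Fin N) :=
  (Homeomorph.piCongrRight fun i =>
    Homeomorph.mulLeft₀ (√(T.gap i.succ)) (Real.sqrt_pos.2 (T.gap_pos _)).ne').trans
    (PiLp.homeomorph 2 (fun _ : Fin N => ℝ)).symm

theorem dist_scale (T : Partition N) (x y : Fin N → ℝ) :
    dist (scale T x) (scale T y) = √(∑ i : Fin N, |x i - y i| ^ 2 * |T.gap i.succ|) := by
  rw [EuclideanSpace.dist_eq]
  congr 1
  refine Finset.sum_congr rfl fun i _ => ?_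
  change dist (√(T.gap i.succ) * x i) (√(T.gap i.succ) * y i) ^ 2 = _
  rw [Real.dist_eq, sq_abs, sq_abs, ← mul_sub, mul_pow, Real.sq_sqrt (T.gap_pos _).le,
    abs_of_pos (T.gap_pos _), mul_comm]

/-- The metric `d^{tᵢ}(x, y) = (∑ᵢ |xᵢ - yᵢ|² |t_{i+1} - tᵢ|)^{1/2}` on `X({tᵢ})`. -/
instance : MetricSpace (PartitionSpace T) where
  dist x y := √(∑ i : Fin N, |x.val i - y.val i| ^ 2 * |T.gap i.succ|)
  dist_self x := by simp
  dist_comm x y := by simp only [abs_sub_comm]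
  dist_triangle x y z := by
    simp only [← dist_scale]
    exact dist_triangle _ _ _
  eq_of_dist_eq_zero {x y} h := by
    rw [← dist_scale, dist_eq_zero] at h
    exact PartitionSpace.ext ((scale T).injective h)

theorem dist_def (x y : PartitionSpace T) :
    dist x y = √(∑ i : Fin N, |x.val i - y.val i| ^ 2 * |T.gap i.succ|) := rfl

theorem val_injective : Function.Injective (val : PartitionSpace T → Fin N → ℝ) :=
  fun _ _ h => PartitionSpace.ext h

theorem range_val : Set.range (val : PartitionSpace T → Fin N → ℝ) = Simplex N :=
  Set.ext fun x => ⟨fun ⟨y, hy⟩ => hy ▸ y.mem, fun hx => ⟨⟨x, hx⟩, rfl⟩⟩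

theorem isInducing_val : IsInducing (val : PartitionSpace T → Fin N → ℝ) := by
  have h : Isometry (scale T ∘ (val : PartitionSpace T → Fin N → ℝ)) :=
    Isometry.of_dist_eq fun x y => dist_scale T x.val y.val
  exact ((scale T).isInducing.of_comp_iff).1 h.isEmbedding.isInducing

/-- `X({tᵢ})` carries the `σ`-algebra of Borel subsets of `Σ_N ⊆ ℝ^N`. -/
instance : MeasurableSpace (PartitionSpace T) := MeasurableSpace.comap val inferInstance

/-- The `σ`-algebra of `X({tᵢ})` is also the Borel `σ`-algebra of the metric `d^{tᵢ}`. -/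
instance : BorelSpace (PartitionSpace T) where
  measurable_eq := by
    rw [isInducing_val.eq_induced, borel_comap, ← BorelSpace.measurable_eq]
    rfl

theorem measurableEmbedding_val : MeasurableEmbedding (val : PartitionSpace T → Fin N → ℝ) where
  injective := val_injective
  measurable := comap_measurable _
  measurableSet_image' := by
    rintro _ ⟨s, hs, rfl⟩
    rw [Set.image_preimage_eq_inter_range, range_val]
    exact hs.inter (measurableSet_simplex N)

/-- Lebesgue measure on `Σ_N`. -/
instance : MeasureSpace (PartitionSpace T) where
  volume := (volume : Measure (Fin N → ℝ)).comap val

theorem map_val_volume :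
    (volume : Measure (PartitionSpace T)).map val = volume.restrict (Simplex N) := by
  rw [← range_val (T := T)]
  exact measurableEmbedding_val.map_comap _

end PartitionSpace

/-! ### The Dirichlet densities and the entropic measure -/

/-- The density
`Γ(β) / ∏ᵢ Γ(β (t_{i+1} - tᵢ)) * ∏ᵢ (x_{i+1} - xᵢ) ^ (β (t_{i+1} - tᵢ) - 1)`, `0 ≤ i ≤ N`. -/
def dirichletDensity (β : ℝ) {N : ℕ} (T : Partition N) (x : Fin N → ℝ) : ℝ :=
  Real.Gamma β / (∏ i : Fin (N + 1), Real.Gamma (β * T.gap i)) *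
    ∏ i : Fin (N + 1), increment x i ^ (β * T.gap i - 1)

/-- The measure `μ_{tᵢ}` on `X({tᵢ})`: the Dirichlet density times Lebesgue measure on `Σ_N`. -/
def partitionMeasure (β : ℝ) {N : ℕ} (T : Partition N) : Measure (PartitionSpace T) :=
  (volume : Measure (PartitionSpace T)).withDensity
    fun x => ENNReal.ofReal (dirichletDensity β T x.val)

theorem measurable_dirichletDensity (β : ℝ) {N : ℕ} (T : Partition N) :
    Measurable (dirichletDensity β T) := by
  refine Measurable.const_mul (Finset.measurable_prod _ fun i _ => ?_) _
  exact ((continuous_extend _).measurable.sub (continuous_extend _).measurable).pow_const _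

theorem dirichletDensity_nonneg {β : ℝ} (hβ : 0 < β) {N : ℕ} (T : Partition N)
    {x : Fin N → ℝ} (hx : x ∈ Simplex N) : 0 ≤ dirichletDensity β T x := by
  refine mul_nonneg (div_nonneg (Real.Gamma_pos_of_pos hβ).le ?_) ?_
  · exact Finset.prod_nonneg fun i _ => (Real.Gamma_pos_of_pos (mul_pos hβ (T.gap_pos i))).le
  · exact Finset.prod_nonneg fun i _ => Real.rpow_nonneg (sub_nonneg.2 (hx.monotone
      i.castSucc_lt_succ.le)) _

/-- The formula by which `μ_{tᵢ}` is characterised. -/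
theorem integral_partitionMeasure {β : ℝ} (hβ : 0 < β) {N : ℕ} (T : Partition N)
    (u : (Fin N → ℝ) → ℝ) :
    ∫ x : PartitionSpace T, u x.val ∂(partitionMeasure β T) =
      Real.Gamma β / (∏ i : Fin (N + 1), Real.Gamma (β * T.gap i)) *
        ∫ x in Simplex N, u x * ∏ i : Fin (N + 1), increment x i ^ (β * T.gap i - 1) := by
  have hm : Measurable fun x : PartitionSpace T => ENNReal.ofReal (dirichletDensity β T x.val) :=
    ((measurable_dirichletDensity β T).comp
      PartitionSpace.measurableEmbedding_val.measurable).ennreal_ofReal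
  rw [partitionMeasure, integral_withDensity_eq_integral_toReal_smul hm
    (Eventually.of_forall fun _ => ENNReal.ofReal_lt_top), ← integral_const_mul,
    ← PartitionSpace.map_val_volume (T := T), PartitionSpace.measurableEmbedding_val.integral_map]
  refine integral_congr_ae (Eventually.of_forall fun x => ?_)
  dsimp only
  rw [ENNReal.toReal_ofReal (dirichletDensity_nonneg hβ T x.mem), smul_eq_mul, dirichletDensity]
  ring

/-- The law under `Q` of `(g t₁,…,g t_N)` has the Dirichlet density, for every partition. -/
def HasDirichletMarginals (β : ℝ) (Q : Measure G0) : Prop :=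
  ∀ (N : ℕ) (T : Partition N) (u : (Fin N → ℝ) → ℝ), Measurable u → (∃ C, ∀ x, |u x| ≤ C) →
    ∫ g : G0, u (fun i => (g (T.t i.castSucc.succ) : ℝ)) ∂Q =
      Real.Gamma β / (∏ i : Fin (N + 1), Real.Gamma (β * T.gap i)) *
        ∫ x in Simplex N, u x * ∏ i : Fin (N + 1), increment x i ^ (β * T.gap i - 1)

/-! ### The step functions -/

/-- The largest `xᵢ` with `tᵢ ≤ s`, `0 ≤ i ≤ N + 1`. -/
def stepValue {N : ℕ} (T : Partition N) (x : PartitionSpace T) (s : I) : ℝ :=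
  (Finset.univ.filter fun i => T.t i ≤ s).sup' ⟨0, by simp [T.t_zero]⟩ (extend x.val)

theorem extend_zero {N : ℕ} (x : Fin N → ℝ) : extend x 0 = 0 := by simp [extend]

theorem extend_last {N : ℕ} (x : Fin N → ℝ) : extend x (Fin.last (N + 1)) = 1 := by
  rw [← Fin.succ_last]
  simp [extend]

theorem le_stepValue {N : ℕ} (T : Partition N) (x : PartitionSpace T) {s : I} {i : Fin (N + 2)}
    (h : T.t i ≤ s) : extend x.val i ≤ stepValue T x s :=
  Finset.le_sup' _ (by simpa using h)

theorem stepValue_le {N : ℕ} (T : Partition N) (x : PartitionSpace T) {s : I} {c : ℝ}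
    (h : ∀ i, T.t i ≤ s → extend x.val i ≤ c) : stepValue T x s ≤ c :=
  Finset.sup'_le _ _ fun i hi => h i (by simpa using hi)

theorem stepValue_mem {N : ℕ} (T : Partition N) (x : PartitionSpace T) (s : I) :
    stepValue T x s ∈ I := by
  constructor
  · rw [← extend_zero x.val]
    exact le_stepValue T x (by rw [T.t_zero]; exact unitInterval.nonneg')
  · refine stepValue_le T x fun i _ => ?_
    rw [← extend_last x.val]
    exact x.mem.monotone (Fin.le_last i)

/-- On `[tᵢ, t_{i+1})` the step function takes the value `xᵢ`. -/
theorem stepValue_eq {N : ℕ} (T : Partition N) (x : PartitionSpace T) (i : Fin (N + 1)) (s : I)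
    (h1 : T.t i.castSucc ≤ s) (h2 : s < T.t i.succ) :
    stepValue T x s = extend x.val i.castSucc := by
  refine le_antisymm (stepValue_le T x fun j hj => ?_) (le_stepValue T x h1)
  refine x.mem.monotone (Fin.le_castSucc_iff.2 ?_)
  exact T.strictMono.lt_iff_lt.1 (hj.trans_lt h2)

/-- The element of `𝒢₀` associated with `(x₁,…,x_N)`: the right continuous representative of the
`L²`-class of `∑ᵢ xᵢ χ_{(tᵢ, t_{i+1}]}`. -/
def stepMap {N : ℕ} (T : Partition N) (x : PartitionSpace T) : G0 where
  toFun s := ⟨stepValue T x s, stepValue_mem T x s⟩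
  monotone' s s' h := stepValue_le T x fun i hi => le_stepValue T x (hi.trans h)
  rightCts' s := by
    have hev : ∀ᶠ s' in 𝓝[≥] s, ∀ i, (T.t i ≤ s' ↔ T.t i ≤ s) := by
      rw [eventually_all]
      intro i
      by_cases hi : T.t i ≤ s
      · filter_upwards [self_mem_nhdsWithin] with s' hs'
        exact ⟨fun _ => hi, fun _ => hi.trans hs'⟩
      · filter_upwards [mem_nhdsWithin_of_mem_nhds (Iio_mem_nhds (not_le.1 hi))] with s' hs'
        exact ⟨fun h => absurd h (not_le.2 hs'), fun h => absurd h hi⟩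
    refine (continuousWithinAt_const (b := (⟨stepValue T x s, stepValue_mem T x s⟩ : I))
      ).congr_of_eventuallyEq ?_ rfl
    filter_upwards [hev] with s' hs'
    ext
    exact le_antisymm (stepValue_le T x fun i hi => le_stepValue T x ((hs' i).1 hi))
      (stepValue_le T x fun i hi => le_stepValue T x ((hs' i).2 hi))
  map_one' := by
    ext
    refine le_antisymm (stepValue_mem T x 1).2 ?_
    change (1 : ℝ) ≤ stepValue T x 1
    rw [← extend_last x.val]
    exact le_stepValue T x unitInterval.le_one'

/-! ### Measured Gromov–Hausdorff convergence and the Wasserstein distance -/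

/-- A (not necessarily continuous) map is an `ε`-isometry if it distorts distances by at most `ε`
and every point of the target is within `ε` of its image. -/
def IsEpsIsometry {X Y : Type*} [MetricSpace X] [MetricSpace Y] (ε : ℝ) (f : X → Y) : Prop :=
  (∀ x x', |dist x x' - dist (f x) (f x')| ≤ ε) ∧ ∀ y, ∃ x, dist y (f x) ≤ ε

/-- `(X_n, d_n, μ_n)` converges to `(Y, d, ν)` in the measured Gromov–Hausdorff topology: there are
`ε_n → 0` and Borel `ε_n`-isometries `f_n : X_n → Y` with `(f_n)_* μ_n → ν` weakly. -/
def MeasuredGHConverges {X : ℕ → Type*} [∀ n, MetricSpace (X n)] [∀ n, MeasurableSpace (X n)]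
    [∀ n, BorelSpace (X n)] (μ : ∀ n, Measure (X n))
    {Y : Type*} [MetricSpace Y] [MeasurableSpace Y] [BorelSpace Y] (ν : Measure Y) : Prop :=
  ∃ (ε : ℕ → ℝ) (f : ∀ n, X n → Y),
    (∀ n, 0 < ε n) ∧ Tendsto ε atTop (𝓝 0) ∧
    (∀ n, Measurable (f n)) ∧ (∀ n, IsEpsIsometry (ε n) (f n)) ∧
    ∀ u : Y →ᵇ ℝ, Tendsto (fun n => ∫ y, u y ∂(Measure.map (f n) (μ n))) atTop (𝓝 (∫ y, u y ∂ν))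

/-- The `2`-Wasserstein distance `(inf_π ∫ d(x,y)² dπ)^{1/2}`, over the transport plans `π`, i.e.
the measures on the product with marginals `μ` and `ν`. -/
def wassersteinDist {X : Type*} [MetricSpace X] [MeasurableSpace X] (μ ν : Measure X) : ℝ≥0∞ :=
  (⨅ π ∈ {π : Measure (X × X) | π.map Prod.fst = μ ∧ π.map Prod.snd = ν},
    ∫⁻ p, edist p.1 p.2 ^ 2 ∂π) ^ (1 / 2 : ℝ)

end EntropicMeasure

end

/-! Existence of `Q` comes from stick breaking, without Kolmogorov extension or regularisation of
paths. Let `R` have density `β r^(β-1)` on `[0,1]`, let `U` be uniform, and let `X` be a Dirichlet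
vector for `T`, all independent. Then `(1-R) (1_{U ≤ tᵢ})ᵢ + R X` has the law of `X`
(`map_stickStep`). Indeed, given that `U` lies in cell `j`, the combination has the Dirichlet law
biased by `(x_{j+1} - x_j) / (t_{j+1} - t_j)`, and averaging over the cells gives `∑ (x_{j+1} - x_j)
= 1`. Iteration with independent copies leads to the random function `∑ₖ stickₖ 1_{Uₖ ≤ s}`, which
is nondecreasing and right continuous for every outcome. After `n` steps the starting vector only
carries the factor `R₀ ⋯ R_{n-1}`, which tends to `0` almost surely, so the limit inherits the
Dirichlet marginals (`map_stickSum`).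

Everything else is one estimate and one coupling. For any `Q` with Dirichlet marginals, replace `g`
by the step function with the values `g(tᵢ)`. On each cell the difference lies between `0` and the
increment of the adjoined values, which is at most `1`, so its square is at most that increment. The
increments sum to `1`, hence the squared `L²` distance is at most the mesh
(`dist_stepMap_coords_sq_le`). The step function has law `(f^N)_* μ_N` (`map_discretize`), so
approximants and limit live on one probability space. This gives the Wasserstein bounds and weak
convergence; uniqueness follows because the approximating sequence does not depend on `Q`. The maps
`f^N` are isometric, and their images become dense because mixing with the identity makes every `g`
strictly increasing. -/

noncomputable section

namespace EntropicMeasure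

/-! ### Dirichlet integrals -/

/-- The truncated power `r₊ ^ (a - 1)`, with values in `[0,∞]`. -/
def powPos (a r : ℝ) : ℝ≥0∞ := if 0 < r then ENNReal.ofReal (r ^ (a - 1)) else 0

@[fun_prop]
theorem measurable_powPos (a : ℝ) : Measurable (powPos a) :=
  Measurable.ite measurableSet_Ioi (by fun_prop) measurable_const

theorem powPos_of_pos (a : ℝ) {r : ℝ} (hr : 0 < r) :
    powPos a r = ENNReal.ofReal (r ^ (a - 1)) := if_pos hr

theorem powPos_of_nonpos (a : ℝ) {r : ℝ} (hr : r ≤ 0) : powPos a r = 0 := if_neg hr.not_gt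

theorem powPos_mul (a : ℝ) {c : ℝ} (hc : 0 < c) (r : ℝ) :
    powPos a (c * r) = ENNReal.ofReal (c ^ (a - 1)) * powPos a r := by
  rcases le_or_gt r 0 with hr | hr
  · rw [powPos_of_nonpos a hr, powPos_of_nonpos a (mul_nonpos_of_nonneg_of_nonpos hc.le hr),
      mul_zero]
  · rw [powPos_of_pos a hr, powPos_of_pos a (mul_pos hc hr), Real.mul_rpow hc.le hr.le,
      ENNReal.ofReal_mul (Real.rpow_nonneg hc.le _)]

/-- Reduces Euler's beta integral to the fact that the beta distribution has total mass one. -/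
theorem powPos_mul_powPos_one_sub {a b : ℝ} (ha : 0 < a) (hb : 0 < b) (y : ℝ) :
    powPos a y * powPos b (1 - y) =
      ENNReal.ofReal (ProbabilityTheory.beta a b) * ProbabilityTheory.betaPDF a b y := by
  rcases le_or_gt y 0 with hy | hy
  · rw [powPos_of_nonpos a hy, ProbabilityTheory.betaPDF_eq_zero_of_nonpos hy, zero_mul, mul_zero]
  rcases le_or_gt 1 y with hy1 | hy1
  · rw [powPos_of_nonpos b (sub_nonpos.2 hy1), ProbabilityTheory.betaPDF_eq_zero_of_one_le hy1,
      mul_zero, mul_zero]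
  have hB := ProbabilityTheory.beta_pos ha hb
  rw [powPos_of_pos a hy, powPos_of_pos b (sub_pos.2 hy1),
    ProbabilityTheory.betaPDF_of_pos_lt_one hy hy1, ← ENNReal.ofReal_mul hB.le,
    ← ENNReal.ofReal_mul (Real.rpow_nonneg hy.le _)]
  congr 1
  field_simp

theorem lintegral_comp_mul_left {c : ℝ} (hc : 0 < c) {f : ℝ → ℝ≥0∞} (hf : Measurable f) :
    ∫⁻ y, f y = ENNReal.ofReal c * ∫⁻ y, f (c * y) := by
  conv_lhs => rw [← Real.smul_map_volume_mul_left hc.ne']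
  rw [lintegral_smul_measure, lintegral_map hf (by fun_prop), abs_of_pos hc, smul_eq_mul]

/-- The convolution of two truncated powers is given by the beta function. -/
theorem lintegral_powPos_mul_powPos {a b : ℝ} (ha : 0 < a) (hb : 0 < b) (c : ℝ) :
    ∫⁻ y, powPos a y * powPos b (c - y) =
      ENNReal.ofReal (ProbabilityTheory.beta a b) * powPos (a + b) c := by
  rcases le_or_gt c 0 with hc | hc
  · rw [powPos_of_nonpos _ hc, mul_zero, lintegral_eq_zero_iff (by fun_prop)]
    refine Eventually.of_forall fun y => ?_
    rcases le_or_gt y 0 with hy | hy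
    · simp [powPos_of_nonpos a hy]
    · simp [powPos_of_nonpos b (show c - y ≤ 0 by linarith)]
  -- Homogeneity reduces to `c = 1`: the substitution `y ↦ c y` yields `c * c^(a-1) * c^(b-1) =
  -- c^(a+b-1)`.
  · have h : ∀ y, powPos a (c * y) * powPos b (c - c * y) =
        ENNReal.ofReal (c ^ (a - 1) * c ^ (b - 1)) * (powPos a y * powPos b (1 - y)) := by
      intro y
      rw [show c - c * y = c * (1 - y) by ring, powPos_mul a hc, powPos_mul b hc,
        ENNReal.ofReal_mul (Real.rpow_nonneg hc.le _)]
      ring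
    rw [lintegral_comp_mul_left hc (by fun_prop)]
    simp_rw [h, powPos_mul_powPos_one_sub ha hb]
    rw [lintegral_const_mul' _ _ ENNReal.ofReal_ne_top,
      lintegral_const_mul' _ _ ENNReal.ofReal_ne_top,
      ProbabilityTheory.lintegral_betaPDF_eq_one ha hb, mul_one, ← mul_assoc,
      ← ENNReal.ofReal_mul hc.le, mul_comm, powPos_of_pos _ hc]
    congr 2
    rw [← Real.rpow_add hc]
    nth_rewrite 1 [← Real.rpow_one c]
    rw [← Real.rpow_add hc]
    congr 1
    ring

/-- Adjoining `0` and `c` to `(x₁,…,x_N)`. -/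
def extendTo {N : ℕ} (c : ℝ) (x : Fin N → ℝ) : Fin (N + 2) → ℝ :=
  Fin.cons 0 (Fin.snoc x c : Fin (N + 1) → ℝ)

/-- The increments of `extendTo c x`. -/
def incrementTo {N : ℕ} (c : ℝ) (x : Fin N → ℝ) (i : Fin (N + 1)) : ℝ :=
  extendTo c x i.succ - extendTo c x i.castSucc

theorem incrementTo_one {N : ℕ} (x : Fin N → ℝ) : incrementTo 1 x = increment x := rfl

theorem extendTo_snoc_castSucc {N : ℕ} (c y : ℝ) (x : Fin N → ℝ) (i : Fin (N + 2)) :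
    extendTo c (Fin.snoc x y : Fin (N + 1) → ℝ) i.castSucc = extendTo y x i := by
  unfold extendTo
  refine Fin.cases ?_ (fun j => ?_) i
  · simp
  · rw [← Fin.succ_castSucc, Fin.cons_succ, Fin.cons_succ, Fin.snoc_castSucc]

theorem extendTo_last {N : ℕ} (c : ℝ) (x : Fin N → ℝ) :
    extendTo c x (Fin.last (N + 1)) = c := by
  rw [← Fin.succ_last]
  simp [extendTo]

theorem incrementTo_snoc_castSucc {N : ℕ} (c y : ℝ) (x : Fin N → ℝ) (i : Fin (N + 1)) :
    incrementTo c (Fin.snoc x y : Fin (N + 1) → ℝ) i.castSucc = incrementTo y x i := by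
  unfold incrementTo
  rw [Fin.succ_castSucc, extendTo_snoc_castSucc, extendTo_snoc_castSucc]

theorem incrementTo_snoc_last {N : ℕ} (c y : ℝ) (x : Fin N → ℝ) :
    incrementTo c (Fin.snoc x y : Fin (N + 1) → ℝ) (Fin.last _) = c - y := by
  unfold incrementTo
  rw [Fin.succ_last, extendTo_last, extendTo_snoc_castSucc, extendTo_last]

@[fun_prop]
theorem measurable_extendTo {N : ℕ} (c : ℝ) (i : Fin (N + 2)) :
    Measurable fun x : Fin N → ℝ => extendTo c x i := by
  unfold extendTo
  refine Fin.cases ?_ (fun j => ?_) i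
  · simp
  · refine Fin.lastCases ?_ (fun k => ?_) j
    · simp
    · simpa using measurable_pi_apply k

@[fun_prop]
theorem measurable_incrementTo {N : ℕ} (c : ℝ) (i : Fin (N + 1)) :
    Measurable fun x : Fin N → ℝ => incrementTo c x i :=
  (measurable_extendTo c _).sub (measurable_extendTo c _)

theorem measurable_prod_powPos {N : ℕ} (a : Fin (N + 1) → ℝ) (c : ℝ) :
    Measurable fun x : Fin N → ℝ => ∏ i, powPos (a i) (incrementTo c x i) := by
  fun_prop

/-- Integration over `ℝ^{N+1}`, the last coordinate last. -/
theorem lintegral_snoc {N : ℕ} {f : (Fin (N + 1) → ℝ) → ℝ≥0∞} (hf : Measurable f) :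
    ∫⁻ x, f x = ∫⁻ y : ℝ, ∫⁻ x : Fin N → ℝ, f (Fin.snoc x y : Fin (N + 1) → ℝ) := by
  have h := (volume_preserving_piFinSuccAbove (fun _ : Fin (N + 1) => ℝ) (Fin.last N)).symm
  rw [← h.lintegral_comp hf, Measure.volume_eq_prod, lintegral_prod]
  · refine lintegral_congr fun y => lintegral_congr fun x => congrArg f ?_
    exact Fin.insertNth_last' y x
  · exact (hf.comp h.measurable).aemeasurable

/-- The Dirichlet integral. -/
theorem lintegral_prod_powPos : ∀ (N : ℕ) (a : Fin (N + 1) → ℝ), (∀ i, 0 < a i) → ∀ c : ℝ,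
    ∫⁻ x : Fin N → ℝ, ∏ i, powPos (a i) (incrementTo c x i) =
      ENNReal.ofReal ((∏ i, Real.Gamma (a i)) / Real.Gamma (∑ i, a i)) * powPos (∑ i, a i) c
  | 0, a, ha, c => by
    rw [volume_pi, Measure.pi_of_empty, lintegral_dirac]
    have : Real.Gamma (a 0) ≠ 0 := (Real.Gamma_pos_of_pos (ha 0)).ne'
    simp [incrementTo, extendTo, Fin.snoc, this]
  | N + 1, a, ha, c => by
    have hs : 0 < ∑ i : Fin (N + 1), a i.castSucc :=
      Finset.sum_pos (fun i _ => ha _) Finset.univ_nonempty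
    rw [lintegral_snoc (measurable_prod_powPos a c)]
    -- With the last coordinate `y` fixed, the other coordinates form the same problem with endpoint
    -- `y`; hence the induction over an arbitrary endpoint `c`. What remains is a convolution of two
    -- truncated powers.
    have h : ∀ y : ℝ, ∫⁻ x : Fin N → ℝ,
        ∏ i, powPos (a i) (incrementTo c (Fin.snoc x y : Fin (N + 1) → ℝ) i) =
        ENNReal.ofReal ((∏ i : Fin (N + 1), Real.Gamma (a i.castSucc)) /
          Real.Gamma (∑ i : Fin (N + 1), a i.castSucc)) *
        (powPos (∑ i : Fin (N + 1), a i.castSucc) y * powPos (a (Fin.last _)) (c - y)) := by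
      intro y
      simp_rw [Fin.prod_univ_castSucc (n := N + 1), incrementTo_snoc_castSucc,
        incrementTo_snoc_last]
      rw [lintegral_mul_const _ (measurable_prod_powPos _ y),
        lintegral_prod_powPos N _ (fun i => ha _) y, mul_assoc]
    have hG := Real.Gamma_pos_of_pos hs
    simp_rw [h]
    rw [lintegral_const_mul _ (by fun_prop), lintegral_powPos_mul_powPos hs (ha _),
      ← mul_assoc, ← ENNReal.ofReal_mul (div_nonneg (Finset.prod_nonneg fun i _ =>
        (Real.Gamma_pos_of_pos (ha _)).le) hG.le), Fin.sum_univ_castSucc (n := N + 1),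
      Fin.prod_univ_castSucc (n := N + 1)]
    congr 2
    unfold ProbabilityTheory.beta
    field_simp

/-! ### The Dirichlet distributions -/

theorem sum_gap {N : ℕ} (T : Partition N) : ∑ i, T.gap i = 1 := by
  have h := Fin.sum_univ_succ (fun i : Fin (N + 2) => (T.t i : ℝ))
  rw [Fin.sum_univ_castSucc, T.t_zero, T.t_last] at h
  simp only [Partition.gap, Finset.sum_sub_distrib]
  simp only [Set.Icc.coe_one, Set.Icc.coe_zero] at h
  linarith

theorem sum_increment {N : ℕ} (x : Fin N → ℝ) : ∑ i, increment x i = 1 := by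
  have h := Fin.sum_univ_succ (fun i : Fin (N + 2) => extend x i)
  rw [Fin.sum_univ_castSucc, extend_zero, extend_last] at h
  simp only [increment, Finset.sum_sub_distrib]
  linarith

theorem mem_simplex_iff {N : ℕ} (x : Fin N → ℝ) : x ∈ Simplex N ↔ ∀ i, 0 < increment x i := by
  simp [Simplex, Fin.strictMono_iff_lt_succ, increment]

/-- The density of the Dirichlet distribution up to normalisation, extended by `0`. -/
def dirichletWeight (β : ℝ) {N : ℕ} (T : Partition N) (x : Fin N → ℝ) : ℝ≥0∞ :=
  ∏ i, powPos (β * T.gap i) (increment x i)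

@[fun_prop]
theorem measurable_dirichletWeight (β : ℝ) {N : ℕ} (T : Partition N) :
    Measurable (dirichletWeight β T) :=
  measurable_prod_powPos (fun i => β * T.gap i) 1

theorem dirichletWeight_of_notMem {β : ℝ} {N : ℕ} {T : Partition N} {x : Fin N → ℝ}
    (hx : x ∉ Simplex N) : dirichletWeight β T x = 0 := by
  rw [mem_simplex_iff] at hx
  push Not at hx
  obtain ⟨i, hi⟩ := hx
  exact Finset.prod_eq_zero (Finset.mem_univ i) (powPos_of_nonpos _ hi)

/-- The normalising constant of the Dirichlet distribution. -/
def dirichletConst (β : ℝ) {N : ℕ} (T : Partition N) : ℝ :=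
  Real.Gamma β / ∏ i : Fin (N + 1), Real.Gamma (β * T.gap i)

theorem dirichletConst_pos {β : ℝ} (hβ : 0 < β) {N : ℕ} (T : Partition N) :
    0 < dirichletConst β T :=
  div_pos (Real.Gamma_pos_of_pos hβ)
    (Finset.prod_pos fun i _ => Real.Gamma_pos_of_pos (mul_pos hβ (T.gap_pos i)))

theorem ofReal_dirichletDensity {β : ℝ} (hβ : 0 < β) {N : ℕ} (T : Partition N) {x : Fin N → ℝ}
    (hx : x ∈ Simplex N) : ENNReal.ofReal (dirichletDensity β T x) =
      ENNReal.ofReal (dirichletConst β T) * dirichletWeight β T x := by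
  have hx' := (mem_simplex_iff x).1 hx
  rw [dirichletDensity, ← dirichletConst, ENNReal.ofReal_mul (dirichletConst_pos hβ T).le,
    ENNReal.ofReal_prod_of_nonneg fun i _ => Real.rpow_nonneg (hx' i).le _]
  exact congrArg _ (Finset.prod_congr rfl fun i _ => (powPos_of_pos _ (hx' i)).symm)

/-- The law of `(x₁,…,x_N)` under `μ_T`, as a measure on `ℝ^N`. -/
def dirichletLaw (β : ℝ) {N : ℕ} (T : Partition N) : Measure (Fin N → ℝ) :=
  (partitionMeasure β T).map PartitionSpace.val

/-- The truncated weight vanishes off the simplex, so the integral runs over all of `ℝ^N`, where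
affine substitutions need no bookkeeping of domains. -/
theorem lintegral_dirichletLaw {β : ℝ} (hβ : 0 < β) {N : ℕ} (T : Partition N)
    {f : (Fin N → ℝ) → ℝ≥0∞} (hf : Measurable f) :
    ∫⁻ x, f x ∂(dirichletLaw β T) =
      ENNReal.ofReal (dirichletConst β T) * ∫⁻ x, f x * dirichletWeight β T x := by
  have hval := (PartitionSpace.measurableEmbedding_val (T := T))
  have hfin : ∫⁻ x, f x * dirichletWeight β T x =
      ∫⁻ x in Simplex N, f x * dirichletWeight β T x := by
    refine (setLIntegral_eq_of_support_subset fun x hx => ?_).symm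
    by_contra hc
    exact hx (by simp [dirichletWeight_of_notMem hc])
  have hd : Measurable fun x : PartitionSpace T => ENNReal.ofReal (dirichletDensity β T x.val) :=
    ((measurable_dirichletDensity β T).comp hval.measurable).ennreal_ofReal
  have hf' : Measurable fun x : PartitionSpace T => f x.val := hf.comp hval.measurable
  rw [dirichletLaw, hval.lintegral_map, partitionMeasure,
    lintegral_withDensity_eq_lintegral_mul _ hd hf', hfin, ← PartitionSpace.map_val_volume (T := T),
    hval.lintegral_map, ← lintegral_const_mul' _ _ ENNReal.ofReal_ne_top]
  refine lintegral_congr fun x => ?_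
  simp only [Pi.mul_apply]
  rw [ofReal_dirichletDensity hβ T x.mem]
  ring

/-- The gaps sum to `1`, so the parameters sum to `β`, and the Dirichlet integral with endpoint `1`
is the reciprocal of the normalising constant. -/
theorem dirichletLaw_univ {β : ℝ} (hβ : 0 < β) {N : ℕ} (T : Partition N) :
    dirichletLaw β T Set.univ = 1 := by
  have hp : 0 < ∏ i : Fin (N + 1), Real.Gamma (β * T.gap i) :=
    Finset.prod_pos fun i _ => Real.Gamma_pos_of_pos (mul_pos hβ (T.gap_pos i))
  have hG := Real.Gamma_pos_of_pos hβ
  have h := lintegral_dirichletLaw hβ T (f := fun _ => 1) measurable_const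
  have h2 := lintegral_prod_powPos N (fun i => β * T.gap i) (fun i => mul_pos hβ (T.gap_pos i)) 1
  rw [← Finset.mul_sum, sum_gap, mul_one, powPos_of_pos β one_pos, Real.one_rpow,
    ENNReal.ofReal_one, mul_one] at h2
  simp only [one_mul, lintegral_one] at h
  rw [h]
  unfold dirichletWeight
  simp only [incrementTo_one] at h2
  rw [h2, dirichletConst, ← ENNReal.ofReal_mul (div_pos hG hp).le, div_mul_div_cancel₀ hp.ne',
    div_self hG.ne', ENNReal.ofReal_one]

theorem isProbabilityMeasure_partitionMeasure {β : ℝ} (hβ : 0 < β) {N : ℕ} (T : Partition N) :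
    IsProbabilityMeasure (partitionMeasure β T) := by
  have h := dirichletLaw_univ hβ T
  rw [dirichletLaw, Measure.map_apply PartitionSpace.measurableEmbedding_val.measurable .univ,
    Set.preimage_univ] at h
  exact ⟨h⟩

/-! ### Cells of a partition -/

theorem exists_castSucc_le_lt_succ {α : Type*} [LinearOrder α] {n : ℕ} (t : Fin (n + 1) → α)
    {s : α} (h0 : t 0 ≤ s) (h1 : s < t (Fin.last n)) :
    ∃ i : Fin n, t i.castSucc ≤ s ∧ s < t i.succ := by
  by_contra! hc
  exact absurd (Fin.induction (motive := fun i => t i ≤ s) h0 hc (Fin.last n)) h1.not_ge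

theorem exists_castSucc_lt_le_succ {α : Type*} [LinearOrder α] {n : ℕ} (t : Fin (n + 1) → α)
    {s : α} (h0 : t 0 < s) (h1 : s ≤ t (Fin.last n)) :
    ∃ i : Fin n, t i.castSucc < s ∧ s ≤ t i.succ := by
  by_contra! hc
  exact absurd (Fin.induction (motive := fun i => t i < s) h0 hc (Fin.last n)) h1.not_gt

namespace Partition

variable {N : ℕ} (T : Partition N)

/-- Both kinds of cells occur: `Ico` suits right continuous step functions, `Ioc` suits the position
`u` of a jump, since `1_{u ≤ tᵢ}` depends only on the `Ioc` cell of `u`. -/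
theorem exists_mem_Ico {s : I} (hs : s < 1) :
    ∃ i : Fin (N + 1), s ∈ Set.Ico (T.t i.castSucc) (T.t i.succ) :=
  exists_castSucc_le_lt_succ T.t (T.t_zero ▸ unitInterval.nonneg') (T.t_last ▸ hs)

theorem exists_mem_Ioc {s : I} (hs : 0 < s) :
    ∃ i : Fin (N + 1), s ∈ Set.Ioc (T.t i.castSucc) (T.t i.succ) :=
  exists_castSucc_lt_le_succ T.t (T.t_zero ▸ hs) (T.t_last ▸ unitInterval.le_one')

theorem eq_of_mem_Ico {s : I} {i j : Fin (N + 1)}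
    (hi : s ∈ Set.Ico (T.t i.castSucc) (T.t i.succ))
    (hj : s ∈ Set.Ico (T.t j.castSucc) (T.t j.succ)) : i = j := by
  have h1 := T.strictMono.lt_iff_lt.1 (hi.1.trans_lt hj.2)
  have h2 := T.strictMono.lt_iff_lt.1 (hj.1.trans_lt hi.2)
  exact le_antisymm (Fin.castSucc_lt_succ_iff.1 h1) (Fin.castSucc_lt_succ_iff.1 h2)

theorem eq_of_mem_Ioc {s : I} {i j : Fin (N + 1)}
    (hi : s ∈ Set.Ioc (T.t i.castSucc) (T.t i.succ))
    (hj : s ∈ Set.Ioc (T.t j.castSucc) (T.t j.succ)) : i = j := by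
  have h1 := T.strictMono.lt_iff_lt.1 (hi.1.trans_le hj.2)
  have h2 := T.strictMono.lt_iff_lt.1 (hj.1.trans_le hi.2)
  exact le_antisymm (Fin.castSucc_lt_succ_iff.1 h1) (Fin.castSucc_lt_succ_iff.1 h2)

/-- The integral of a function that is constant on the cells `(tᵢ, t_{i+1}]`. -/
theorem lintegral_of_eq_on_Ioc (F : I → ℝ≥0∞) (c : Fin (N + 1) → ℝ≥0∞)
    (hF : ∀ i, ∀ s ∈ Set.Ioc (T.t i.castSucc) (T.t i.succ), F s = c i) :
    ∫⁻ s, F s = ∑ i, ENNReal.ofReal (T.gap i) * c i := by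
  have h : F =ᵐ[volume] fun s => ∑ i, (Set.Ioc (T.t i.castSucc) (T.t i.succ)).indicator
      (fun _ => c i) s := by
    filter_upwards [compl_mem_ae_iff.2 (measure_singleton (0 : I))] with s hs
    obtain ⟨i, hi⟩ := T.exists_mem_Ioc (unitInterval.pos_iff_ne_zero.2 hs)
    rw [hF i s hi, Finset.sum_eq_single i, Set.indicator_of_mem hi]
    · exact fun j _ hj => Set.indicator_of_notMem (fun hc => hj (T.eq_of_mem_Ioc hc hi)) _
    · simp
  rw [lintegral_congr_ae h, lintegral_finsetSum _ fun i _ =>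
    measurable_const.indicator measurableSet_Ioc]
  refine Finset.sum_congr rfl fun i _ => ?_
  rw [lintegral_indicator_const measurableSet_Ioc, unitInterval.volume_Ioc, mul_comm]
  rfl

theorem sum_indicator_Ico (c : Fin (N + 1) → ℝ≥0∞) {s : I} {i : Fin (N + 1)}
    (hi : s ∈ Set.Ico (T.t i.castSucc) (T.t i.succ)) :
    ∑ j, (Set.Ico (T.t j.castSucc) (T.t j.succ)).indicator (fun _ => c j) s = c i := by
  rw [Finset.sum_eq_single i, Set.indicator_of_mem hi]
  · exact fun j _ hj => Set.indicator_of_notMem (fun hc => hj (T.eq_of_mem_Ico hc hi)) _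
  · simp

theorem lintegral_sum_indicator_Ico (c : Fin (N + 1) → ℝ≥0∞) :
    ∫⁻ s : I, ∑ j, (Set.Ico (T.t j.castSucc) (T.t j.succ)).indicator (fun _ => c j) s =
      ∑ i, ENNReal.ofReal (T.gap i) * c i := by
  rw [lintegral_finsetSum _ fun i _ => measurable_const.indicator measurableSet_Ico]
  refine Finset.sum_congr rfl fun i _ => ?_
  rw [lintegral_indicator_const measurableSet_Ico, unitInterval.volume_Ico, mul_comm]
  rfl

/-- The integral of a function that is constant on the cells `[tᵢ, t_{i+1})`. -/
theorem lintegral_of_eq_on_Ico (F : I → ℝ≥0∞) (c : Fin (N + 1) → ℝ≥0∞)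
    (hF : ∀ i, ∀ s ∈ Set.Ico (T.t i.castSucc) (T.t i.succ), F s = c i) :
    ∫⁻ s, F s = ∑ i, ENNReal.ofReal (T.gap i) * c i := by
  rw [← T.lintegral_sum_indicator_Ico]
  refine lintegral_congr_ae ?_
  filter_upwards [compl_mem_ae_iff.2 (measure_singleton (1 : I))] with s hs
  obtain ⟨i, hi⟩ := T.exists_mem_Ico (unitInterval.lt_one_iff_ne_one.2 hs)
  rw [hF i s hi, T.sum_indicator_Ico c hi]

theorem lintegral_le_of_le_on_Ico (F : I → ℝ≥0∞) (c : Fin (N + 1) → ℝ≥0∞)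
    (hF : ∀ i, ∀ s ∈ Set.Ico (T.t i.castSucc) (T.t i.succ), F s ≤ c i) :
    ∫⁻ s, F s ≤ ∑ i, ENNReal.ofReal (T.gap i) * c i := by
  rw [← T.lintegral_sum_indicator_Ico]
  refine lintegral_mono_ae ?_
  filter_upwards [compl_mem_ae_iff.2 (measure_singleton (1 : I))] with s hs
  obtain ⟨i, hi⟩ := T.exists_mem_Ico (unitInterval.lt_one_iff_ne_one.2 hs)
  rw [T.sum_indicator_Ico c hi]
  exact hF i s hi

end Partition

/-! ### The law of the remaining mass -/

/-- The beta integral with second parameter `1`: the factor `powPos 1 (1 - r)` is the indicator of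
`r < 1`. -/
theorem setLIntegral_powPos {a : ℝ} (ha : 0 < a) :
    ∫⁻ r in Set.Ioo (0 : ℝ) 1, powPos a r = ENNReal.ofReal a⁻¹ := by
  have h := lintegral_powPos_mul_powPos ha one_pos 1
  have hB : ProbabilityTheory.beta a 1 = a⁻¹ := by
    rw [ProbabilityTheory.beta, Real.Gamma_one, mul_one, Real.Gamma_add_one ha.ne']
    have := (Real.Gamma_pos_of_pos ha).ne'
    field_simp
  rw [hB, powPos_of_pos _ one_pos, Real.one_rpow, ENNReal.ofReal_one, mul_one] at h
  rw [← h, ← lintegral_indicator measurableSet_Ioo]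
  refine lintegral_congr fun r => ?_
  by_cases hr : r ∈ Set.Ioo (0 : ℝ) 1
  · rw [Set.indicator_of_mem hr, powPos_of_pos 1 (sub_pos.2 hr.2)]
    simp
  · rw [Set.indicator_of_notMem hr]
    rcases le_or_gt r 0 with h0 | h0
    · rw [powPos_of_nonpos a h0, zero_mul]
    · rw [powPos_of_nonpos 1 (sub_nonpos.2 (not_lt.1 fun h1 => hr ⟨h0, h1⟩)), mul_zero]

/-- The convolution with `powPos 1` after `y = 1 - r`. Since `c ≤ 1`, the integrand already vanishes
for `r ≤ 0`, so restricting to `(0,1)` loses nothing. -/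
theorem setLIntegral_powPos_sub {a c : ℝ} (ha : 0 < a) (hc : c ≤ 1) :
    ∫⁻ r in Set.Ioo (0 : ℝ) 1, powPos a (c - (1 - r)) =
      ENNReal.ofReal a⁻¹ * powPos (a + 1) c := by
  have h := lintegral_powPos_mul_powPos one_pos ha c
  have hB : ProbabilityTheory.beta 1 a = a⁻¹ := by
    rw [ProbabilityTheory.beta, Real.Gamma_one, one_mul, add_comm, Real.Gamma_add_one ha.ne']
    have := (Real.Gamma_pos_of_pos ha).ne'
    field_simp
  rw [hB, add_comm 1 a, ← lintegral_sub_left_eq_self _ (1 : ℝ)] at h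
  rw [← h, ← lintegral_indicator measurableSet_Ioo]
  refine lintegral_congr fun r => ?_
  by_cases hr : r ∈ Set.Ioo (0 : ℝ) 1
  · rw [Set.indicator_of_mem hr, powPos_of_pos 1 (sub_pos.2 hr.2)]
    simp
  · rw [Set.indicator_of_notMem hr]
    rcases le_or_gt 1 r with h1 | h1
    · rw [powPos_of_nonpos 1 (sub_nonpos.2 h1), zero_mul]
    · rw [powPos_of_nonpos a (r := c - (1 - r)), mul_zero]
      have : r ≤ 0 := not_lt.1 fun h0 => hr ⟨h0, h1⟩
      linarith

/-- The probability measure on `[0,1]` with density `β r ^ (β - 1)`. -/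
def radiusLaw (β : ℝ) : Measure I :=
  volume.withDensity fun r => ENNReal.ofReal β * powPos β r

theorem lintegral_radiusLaw (β : ℝ) {G : ℝ → ℝ≥0∞} (hG : Measurable G) :
    ∫⁻ r : I, G r ∂(radiusLaw β) =
      ENNReal.ofReal β * ∫⁻ r in Set.Ioo (0 : ℝ) 1, powPos β r * G r := by
  have hm : Measurable fun r : ℝ => ENNReal.ofReal β * powPos β r * G r := by fun_prop
  have hG' : Measurable fun r : I => G r := hG.comp measurable_subtype_coe
  rw [radiusLaw, lintegral_withDensity_eq_lintegral_mul _ (by fun_prop) hG']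
  have h := unitInterval.measurePreserving_coe.lintegral_comp hm
  rw [Measure.restrict_congr_set Ioo_ae_eq_Icc.symm] at h
  refine h.trans ?_
  rw [← lintegral_const_mul' _ _ ENNReal.ofReal_ne_top]
  simp only [mul_assoc]

theorem isProbabilityMeasure_radiusLaw {β : ℝ} (hβ : 0 < β) :
    IsProbabilityMeasure (radiusLaw β) := by
  have h := lintegral_radiusLaw β (G := fun _ => 1) measurable_const
  simp only [mul_one, lintegral_one] at h
  rw [setLIntegral_powPos hβ, ← ENNReal.ofReal_mul hβ.le, mul_inv_cancel₀ hβ.ne',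
    ENNReal.ofReal_one] at h
  exact ⟨h⟩

/-- This mean is less than `1`, which makes the expected remaining mass decay geometrically. -/
theorem lintegral_radiusLaw_id {β : ℝ} (hβ : 0 < β) :
    ∫⁻ r : I, ENNReal.ofReal r ∂(radiusLaw β) = ENNReal.ofReal (β / (β + 1)) := by
  rw [lintegral_radiusLaw β ENNReal.measurable_ofReal]
  have h : ∀ r ∈ Set.Ioo (0 : ℝ) 1, powPos β r * ENNReal.ofReal r = powPos (β + 1) r := by
    intro r hr
    rw [powPos_of_pos _ hr.1, powPos_of_pos _ hr.1, ← ENNReal.ofReal_mul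
      (Real.rpow_nonneg hr.1.le _), ← Real.rpow_add_one hr.1.ne']
    congr 2
    ring
  rw [setLIntegral_congr_fun measurableSet_Ioo h, setLIntegral_powPos (by linarith),
    ← ENNReal.ofReal_mul hβ.le, div_eq_mul_inv]

/-! ### The distributional fixed point equation -/

theorem lintegral_comp_smul_add {N : ℕ} {r : ℝ} (hr : 0 < r) (b : Fin N → ℝ)
    {f : (Fin N → ℝ) → ℝ≥0∞} (hf : Measurable f) :
    ∫⁻ x : Fin N → ℝ, f (b + r • x) = ENNReal.ofReal ((r ^ N)⁻¹) * ∫⁻ y, f y := by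
  have h := lintegral_map (μ := (volume : Measure (Fin N → ℝ))) (f := fun y => f (b + y))
    (g := fun x : Fin N → ℝ => r • x) (by fun_prop) (by fun_prop)
  rw [Measure.map_addHaar_smul _ hr.ne', lintegral_smul_measure, Module.finrank_fin_fun,
    abs_of_pos (by positivity), lintegral_add_left_eq_self] at h
  exact h.symm

/-- The vector `(1_{u ≤ t₁},…,1_{u ≤ t_N})`. -/
def jump {N : ℕ} (T : Partition N) (u : I) (i : Fin N) : ℝ :=
  if u ≤ T.t i.castSucc.succ then 1 else 0

theorem extend_jump {N : ℕ} (T : Partition N) {u : I} (hu : 0 < u) (k : Fin (N + 2)) :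
    extend (jump T u) k = if u ≤ T.t k then 1 else 0 := by
  refine Fin.cases ?_ (fun j => ?_) k
  · rw [extend_zero, T.t_zero, if_neg hu.not_ge]
  · refine Fin.lastCases ?_ (fun l => ?_) j
    · rw [Fin.succ_last, extend_last, T.t_last, if_pos unitInterval.le_one']
    · simp [extend, jump]

theorem increment_jump {N : ℕ} (T : Partition N) {u : I} {j : Fin (N + 1)}
    (hu : u ∈ Set.Ioc (T.t j.castSucc) (T.t j.succ)) (i : Fin (N + 1)) :
    increment (jump T u) i = if i = j then 1 else 0 := by
  have hu0 : 0 < u := unitInterval.nonneg'.trans_lt hu.1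
  rw [increment, extend_jump T hu0, extend_jump T hu0]
  rcases lt_trichotomy i j with h | rfl | h
  · have h1 : T.t i.succ < u := (T.strictMono.monotone (Fin.succ_le_castSucc_iff.2 h)).trans_lt hu.1
    have h2 : T.t i.castSucc < u := (T.strictMono i.castSucc_lt_succ).trans h1
    rw [if_neg h1.not_ge, if_neg h2.not_ge, if_neg h.ne, sub_zero]
  · rw [if_pos hu.2, if_neg hu.1.not_ge, if_pos rfl, sub_zero]
  · have h1 : u ≤ T.t i.castSucc := hu.2.trans (T.strictMono.monotone
      (Fin.succ_le_castSucc_iff.2 h))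
    rw [if_pos h1, if_pos (h1.trans (T.strictMono i.castSucc_lt_succ).le), if_neg h.ne', sub_self]

theorem extend_affine {N : ℕ} (r : ℝ) (x y : Fin N → ℝ) (i : Fin (N + 2)) :
    extend ((1 - r) • x + r • y) i = (1 - r) * extend x i + r * extend y i := by
  refine Fin.cases ?_ (fun j => ?_) i
  · simp [extend]
  · refine Fin.lastCases ?_ (fun l => ?_) j
    · simp [extend]
    · simp [extend]

theorem increment_affine {N : ℕ} (r : ℝ) (x y : Fin N → ℝ) (i : Fin (N + 1)) :
    increment ((1 - r) • x + r • y) i = (1 - r) * increment x i + r * increment y i := by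
  rw [increment, extend_affine, extend_affine, increment, increment]
  ring

@[fun_prop]
theorem measurable_increment {N : ℕ} (i : Fin (N + 1)) :
    Measurable fun x : Fin N → ℝ => increment x i :=
  measurable_incrementTo 1 i

theorem increment_le_one {N : ℕ} {x : Fin N → ℝ} (hx : x ∈ Simplex N) (i : Fin (N + 1)) :
    increment x i ≤ 1 := by
  rw [← sum_increment x]
  exact Finset.single_le_sum (fun j _ => ((mem_simplex_iff x).1 hx j).le) (Finset.mem_univ i)

/-- The weight after the change of variables `y = (1 - r) θ + r x`. -/
theorem powPos_mul_dirichletWeight {β : ℝ} {N : ℕ} (T : Partition N) {r : ℝ} (hr : 0 < r)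
    (θ y : Fin N → ℝ) (x : Fin N → ℝ) (hxy : y = (1 - r) • θ + r • x) :
    ENNReal.ofReal ((r ^ N)⁻¹) * (powPos β r * dirichletWeight β T x) =
      ∏ i, powPos (β * T.gap i) (increment y i - (1 - r) * increment θ i) := by
  have h : ∀ i, powPos (β * T.gap i) (increment y i - (1 - r) * increment θ i) =
      ENNReal.ofReal (r ^ (β * T.gap i - 1)) * powPos (β * T.gap i) (increment x i) := by
    intro i
    rw [hxy, increment_affine, add_sub_cancel_left, powPos_mul _ hr]
  simp_rw [h]
  rw [Finset.prod_mul_distrib, ← ENNReal.ofReal_prod_of_nonneg fun i _ => Real.rpow_nonneg hr.le _,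
    ← Real.rpow_sum_of_pos hr, Finset.sum_sub_distrib, ← Finset.mul_sum, sum_gap, ← mul_assoc,
    powPos_of_pos _ hr, ← ENNReal.ofReal_mul (by positivity), dirichletWeight]
  congr 2
  -- The exponents match because the gaps sum to `1`: `-N + (β - 1) = ∑ (β * gap i - 1)` over `N +
  -- 1` indices. This is why the radius has density proportional to `r^(β-1)`.
  rw [← Real.rpow_natCast, ← Real.rpow_neg hr.le, ← Real.rpow_add hr]
  congr 1
  simp
  ring

/-- A jump in cell `j` affects only the `j`-th increment, so a single factor depends on `r`.
Integrating it raises its exponent by one, which multiplies the weight by `increment y j / (β * gap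
j)`. -/
theorem setLIntegral_prod_powPos {β : ℝ} (hβ : 0 < β) {N : ℕ} (T : Partition N)
    {u : I} {j : Fin (N + 1)} (hu : u ∈ Set.Ioc (T.t j.castSucc) (T.t j.succ)) (y : Fin N → ℝ) :
    ∫⁻ r in Set.Ioo (0 : ℝ) 1,
        ∏ i, powPos (β * T.gap i) (increment y i - (1 - r) * increment (jump T u) i) =
      ENNReal.ofReal ((β * T.gap j)⁻¹) *
        (dirichletWeight β T y * ENNReal.ofReal (increment y j)) := by
  have hj : 0 < β * T.gap j := mul_pos hβ (T.gap_pos j)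
  have hprod : ∀ r : ℝ, ∏ i, powPos (β * T.gap i)
      (increment y i - (1 - r) * increment (jump T u) i) =
      powPos (β * T.gap j) (increment y j - (1 - r)) *
        ∏ i ∈ Finset.univ.erase j, powPos (β * T.gap i) (increment y i) := by
    intro r
    rw [← Finset.mul_prod_erase _ _ (Finset.mem_univ j), increment_jump T hu, if_pos rfl, mul_one]
    congr 1
    refine Finset.prod_congr rfl fun i hi => ?_
    rw [increment_jump T hu, if_neg (Finset.ne_of_mem_erase hi), mul_zero, sub_zero]
  simp_rw [hprod]
  rw [lintegral_mul_const _ (by fun_prop)]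
  by_cases hy : y ∈ Simplex N
  · have hpos := (mem_simplex_iff y).1 hy j
    rw [setLIntegral_powPos_sub hj (increment_le_one hy j), dirichletWeight,
      ← Finset.mul_prod_erase _ _ (Finset.mem_univ j), powPos_of_pos _ hpos, powPos_of_pos _ hpos,
      add_sub_right_comm, Real.rpow_add_one hpos.ne', ENNReal.ofReal_mul
      (Real.rpow_nonneg hpos.le _)]
    ring
  · rw [dirichletWeight_of_notMem hy, zero_mul, mul_zero]
    have hy' := (mem_simplex_iff y).not.1 hy
    push Not at hy'
    obtain ⟨i, hi⟩ := hy'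
    by_cases hij : i = j
    · subst hij
      rw [setLIntegral_eq_zero measurableSet_Ioo, zero_mul]
      intro r hr
      exact powPos_of_nonpos _ (by have := hr.2; linarith)
    · rw [Finset.prod_eq_zero (Finset.mem_erase.2 ⟨hij, Finset.mem_univ i⟩)
        (powPos_of_nonpos _ hi), mul_zero]

/-- Given a jump in cell `j`, one step of stick breaking biases the Dirichlet law by `increment y j
/ gap j`. The substitution `y = (1 - r) θ + r x` at fixed `r`, followed by Tonelli, leaves the
`r`-integral of `setLIntegral_prod_powPos`. -/
theorem lintegral_dirichletLaw_jump {β : ℝ} (hβ : 0 < β) {N : ℕ} (T : Partition N)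
    {f : (Fin N → ℝ) → ℝ≥0∞} (hf : Measurable f)
    {u : I} {j : Fin (N + 1)} (hu : u ∈ Set.Ioc (T.t j.castSucc) (T.t j.succ)) :
    ∫⁻ r : I, ∫⁻ x, f ((1 - (r : ℝ)) • jump T u + (r : ℝ) • x) ∂(dirichletLaw β T)
        ∂(radiusLaw β) =
      ENNReal.ofReal (dirichletConst β T) * ∫⁻ y, f y * (dirichletWeight β T y *
        (ENNReal.ofReal ((T.gap j)⁻¹) * ENNReal.ofReal (increment y j))) := by
  set θ := jump T u
  have h1 : ∀ r ∈ Set.Ioo (0 : ℝ) 1, powPos β r *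
      ∫⁻ x, f ((1 - r) • θ + r • x) ∂(dirichletLaw β T) =
      ENNReal.ofReal (dirichletConst β T) * ∫⁻ y, f y *
        ∏ i, powPos (β * T.gap i) (increment y i - (1 - r) * increment θ i) := by
    intro r hr
    rw [lintegral_dirichletLaw hβ T (by fun_prop), mul_left_comm]
    congr 1
    have hr0 : r ^ N ≠ 0 := pow_ne_zero _ hr.1.ne'
    have h2 := lintegral_comp_smul_add hr.1 ((1 - r) • θ) (f := fun y => f y *
        ∏ i, powPos (β * T.gap i) (increment y i - (1 - r) * increment θ i)) (by fun_prop)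
    simp_rw [← powPos_mul_dirichletWeight T hr.1 θ _ _ rfl] at h2
    have h3 : ∀ x, f ((1 - r) • θ + r • x) * (ENNReal.ofReal ((r ^ N)⁻¹) *
        (powPos β r * dirichletWeight β T x)) = ENNReal.ofReal ((r ^ N)⁻¹) * (powPos β r *
        (f ((1 - r) • θ + r • x) * dirichletWeight β T x)) := fun x => by ring
    simp_rw [h3] at h2
    rw [lintegral_const_mul' _ _ ENNReal.ofReal_ne_top, lintegral_const_mul _ (by fun_prop)] at h2
    refine (ENNReal.mul_right_inj ?_ ENNReal.ofReal_ne_top).1 h2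
    rw [Ne, ENNReal.ofReal_eq_zero, not_le]
    exact inv_pos.2 (pow_pos hr.1 _)
  have hmeas : Measurable fun p : ℝ × (Fin N → ℝ) => f p.2 *
      ∏ i, powPos (β * T.gap i) (increment p.2 i - (1 - p.1) * increment θ i) := by
    fun_prop
  rw [lintegral_radiusLaw β (G := fun r => ∫⁻ x, f ((1 - r) • θ + r • x) ∂(dirichletLaw β T)),
    setLIntegral_congr_fun measurableSet_Ioo h1, lintegral_const_mul' _ _ ENNReal.ofReal_ne_top,
    lintegral_lintegral_swap hmeas.aemeasurable, mul_left_comm,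
    ← lintegral_const_mul' _ _ ENNReal.ofReal_ne_top]
  · congr 1
    refine lintegral_congr fun y => ?_
    rw [lintegral_const_mul _ (by fun_prop), setLIntegral_prod_powPos hβ T hu, mul_inv,
      ENNReal.ofReal_mul (inv_nonneg.2 hβ.le)]
    have hβ' : ENNReal.ofReal β * ENNReal.ofReal β⁻¹ = 1 := by
      rw [← ENNReal.ofReal_mul hβ.le, mul_inv_cancel₀ hβ.ne', ENNReal.ofReal_one]
    calc _ = (ENNReal.ofReal β * ENNReal.ofReal β⁻¹) * (f y * (dirichletWeight β T y *
        (ENNReal.ofReal ((T.gap j)⁻¹) * ENNReal.ofReal (increment y j)))) := by ring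
      _ = _ := by rw [hβ', one_mul]
  · have : IsProbabilityMeasure (dirichletLaw β T) := ⟨dirichletLaw_univ hβ T⟩
    have hm : Measurable fun p : ℝ × (Fin N → ℝ) => f ((1 - p.1) • θ + p.1 • p.2) := by
      fun_prop
    exact hm.lintegral_prod_right'

/-- One step of the stick breaking construction, on the level of `(x₁,…,x_N)`. -/
def stickStep {N : ℕ} (T : Partition N) (p : (I × I) × (Fin N → ℝ)) : Fin N → ℝ :=
  (1 - (p.1.1 : ℝ)) • jump T p.1.2 + (p.1.1 : ℝ) • p.2

@[fun_prop]
theorem measurable_jump {N : ℕ} (T : Partition N) : Measurable (jump T) :=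
  measurable_pi_iff.2 fun _ => Measurable.ite measurableSet_Iic measurable_const measurable_const

@[fun_prop]
theorem measurable_stickStep {N : ℕ} (T : Partition N) : Measurable (stickStep T) := by
  unfold stickStep
  fun_prop

/-- The Dirichlet distributions are invariant under stick breaking. -/
theorem map_stickStep {β : ℝ} (hβ : 0 < β) {N : ℕ} (T : Partition N) :
    (((radiusLaw β).prod volume).prod (dirichletLaw β T)).map (stickStep T) =
      dirichletLaw β T := by
  have : IsProbabilityMeasure (dirichletLaw β T) := ⟨dirichletLaw_univ hβ T⟩
  have := isProbabilityMeasure_radiusLaw hβ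
  refine Measure.ext_of_lintegral _ fun f hf => ?_
  have hm : Measurable fun p => f (stickStep T p) := by fun_prop
  rw [lintegral_map hf (by fun_prop), lintegral_prod _ hm.aemeasurable,
    lintegral_prod_symm _ hm.lintegral_prod_right'.aemeasurable]
  -- With `u` integrated last, the inner integrals depend only on the cell of `u`.
  refine (T.lintegral_of_eq_on_Ioc _ _
    fun j u hu => lintegral_dirichletLaw_jump hβ T hf hu).trans ?_
  rw [lintegral_dirichletLaw hβ T hf]
  simp_rw [mul_left_comm _ (ENNReal.ofReal (dirichletConst β T))]
  rw [← Finset.mul_sum]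
  simp_rw [← lintegral_const_mul' _ _ (ENNReal.ofReal_ne_top (r := T.gap _))]
  rw [← lintegral_finsetSum _ fun i _ => by fun_prop]
  congr 1
  refine lintegral_congr fun y => ?_
  by_cases hy : y ∈ Simplex N
  -- The probability `gap i` of cell `i` cancels the denominator of the bias, and the increments sum
  -- to `1`.
  · have h : ∀ i, ENNReal.ofReal (T.gap i) * (f y * (dirichletWeight β T y *
        (ENNReal.ofReal ((T.gap i)⁻¹) * ENNReal.ofReal (increment y i)))) =
        f y * dirichletWeight β T y * ENNReal.ofReal (increment y i) := by
      intro i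
      have hi : ENNReal.ofReal (T.gap i) * ENNReal.ofReal (T.gap i)⁻¹ = 1 := by
        rw [← ENNReal.ofReal_mul (T.gap_pos i).le, mul_inv_cancel₀ (T.gap_pos i).ne',
          ENNReal.ofReal_one]
      calc _ = (ENNReal.ofReal (T.gap i) * ENNReal.ofReal (T.gap i)⁻¹) *
            (f y * dirichletWeight β T y * ENNReal.ofReal (increment y i)) := by ring
        _ = _ := by rw [hi, one_mul]
    simp_rw [h]
    rw [← Finset.mul_sum, ← ENNReal.ofReal_sum_of_nonneg
      fun i _ => ((mem_simplex_iff y).1 hy i).le, sum_increment, ENNReal.ofReal_one, mul_one]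
  · simp [dirichletWeight_of_notMem hy]

/-! ### Measurability on `𝒢₀` -/

namespace G0

theorem isometry_toL2 : Isometry toL2 := Isometry.of_dist_eq fun _ _ => rfl

instance : SecondCountableTopology G0 :=
  have : Fact ((2 : ℝ≥0∞) ≠ ∞) := ⟨ENNReal.ofNat_ne_top⟩
  isometry_toL2.isEmbedding.isInducing.secondCountableTopology

/-- Unlike point evaluations, integrals over a set are inner products with an indicator, hence
`L²`-continuous. -/
theorem continuous_setIntegral {A : Set I} (hA : MeasurableSet A) :
    Continuous fun g : G0 => ∫ s in A, (g s : ℝ) := by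
  have h : ∀ g : G0, ∫ s in A, (g s : ℝ) =
      inner ℝ (indicatorConstLp 2 hA (measure_ne_top volume A) (1 : ℝ)) (toL2 g) := by
    intro g
    rw [L2.inner_indicatorConstLp_one]
    exact setIntegral_congr_ae hA (g.memLp.coeFn_toLp.mono fun s hs _ => hs.symm)
  simp_rw [h]
  exact continuous_const.inner isometry_toL2.continuous

theorem coe_mono (g : G0) {s t : I} (h : s ≤ t) : (g s : ℝ) ≤ g t := g.monotone' h

theorem integrable (g : G0) : Integrable (fun s : I => (g s : ℝ)) volume :=
  g.memLp.integrable one_le_two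

/-- For `v n ↓ t`, monotonicity squeezes the average of `g` over `(t, v n]` between `g t` and `g (v
n)`. Right continuity then exhibits evaluation at `t` as a limit of continuous functions of `g`. -/
theorem measurable_eval (t : I) : Measurable fun g : G0 => (g t : ℝ) := by
  rcases eq_or_lt_of_le (show t ≤ 1 from t.2.2) with rfl | ht
  · simp only [map_one', measurable_const]
  obtain ⟨v, -, hv, hlim⟩ := exists_seq_strictAnti_tendsto' ht
  have hpos : ∀ n, 0 < (v n : ℝ) - t := fun n => sub_pos.2 (hv n).1
  refine measurable_of_tendsto_metrizable
    (f := fun n (g : G0) => ((v n : ℝ) - t)⁻¹ * ∫ s in Set.Ioc t (v n), (g s : ℝ))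
    (fun n => ((continuous_setIntegral measurableSet_Ioc).const_mul _).measurable)
    (tendsto_pi_nhds.2 fun g => ?_)
  have hlim' : Tendsto (fun n => (g (v n) : ℝ)) atTop (𝓝 (g t)) :=
    (continuous_subtype_val.tendsto _).comp ((g.rightCts' t).tendsto.comp
      (tendsto_nhdsWithin_iff.2 ⟨hlim, Eventually.of_forall fun n => (hv n).1.le⟩))
  have hconst : ∀ (n : ℕ) (c : ℝ), ∫ _ in Set.Ioc t (v n), c = ((v n : ℝ) - t) * c := by
    intro n c
    rw [setIntegral_const, measureReal_def, unitInterval.volume_Ioc,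
      ENNReal.toReal_ofReal (hpos n).le, smul_eq_mul]
  refine tendsto_of_tendsto_of_tendsto_of_le_of_le tendsto_const_nhds hlim' (fun n => ?_)
    fun n => ?_
  · rw [le_inv_mul_iff₀ (hpos n), ← hconst]
    exact setIntegral_mono_on (integrable_const _).integrableOn g.integrable.integrableOn
      measurableSet_Ioc fun s hs => g.coe_mono hs.1.le
  · rw [inv_mul_le_iff₀ (hpos n), ← hconst]
    exact setIntegral_mono_on g.integrable.integrableOn (integrable_const _).integrableOn
      measurableSet_Ioc fun s hs => g.coe_mono hs.2

/-- A random element of `𝒢₀` is measurable if it is a jointly measurable process. -/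
theorem measurable_of_uncurry {Ω : Type*} [MeasurableSpace Ω] {X : Ω → G0}
    (hX : Measurable fun p : Ω × I => (X p.1 p.2 : ℝ)) : Measurable X := by
  have hdist : ∀ g : G0, Measurable fun ω => dist (X ω) g := by
    intro g
    have h : ∀ ω, dist (X ω) g = √(∫ s : I, ((X ω s : ℝ) - (g s : ℝ)) ^ 2) := fun ω => by
      rw [← dist_sq, Real.sqrt_sq dist_nonneg]
    simp_rw [h]
    have hm : Measurable fun p : Ω × I => ((X p.1 p.2 : ℝ) - (g p.2 : ℝ)) ^ 2 :=
      (hX.sub (g.measurable.comp measurable_snd)).pow_const 2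
    exact hm.stronglyMeasurable.integral_prod_right'.measurable.sqrt
  -- By second countability an open set is a countable union of balls, and preimages of balls are
  -- sublevel sets of the measurable distances `hdist`.
  refine measurable_of_isOpen fun U hU => ?_
  choose! r hr hsub using Metric.isOpen_iff.1 hU
  obtain ⟨C, hC, hCU⟩ := TopologicalSpace.isOpen_iUnion_countable
    (fun g : U => Metric.ball (g : G0) (r g)) fun _ => Metric.isOpen_ball
  have hU' : U = ⋃ g ∈ C, Metric.ball (g : G0) (r g) := by
    rw [hCU]
    refine Set.Subset.antisymm (fun g hg => Set.mem_iUnion.2 ⟨⟨g, hg⟩, ?_⟩)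
      (Set.iUnion_subset fun g => hsub g g.2)
    exact Metric.mem_ball_self (hr g hg)
  rw [hU', Set.preimage_iUnion₂]
  exact MeasurableSet.biUnion hC fun g _ => measurableSet_lt (hdist g) measurable_const

end G0

/-! ### Stick breaking -/

/-- The mass that remains after `n` steps. -/
def remaining (n : ℕ) (ω : ℕ → I × I) : ℝ := ∏ j ∈ Finset.range n, ((ω j).1 : ℝ)

/-- The mass broken off at step `k`. -/
def stick (k : ℕ) (ω : ℕ → I × I) : ℝ := remaining k ω * (1 - (ω k).1)

/-- The sequence without its first term. -/
def shift {α : Type*} (ω : ℕ → α) : ℕ → α := fun n => ω (n + 1)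

theorem remaining_zero (ω : ℕ → I × I) : remaining 0 ω = 1 := rfl

theorem remaining_succ (n : ℕ) (ω : ℕ → I × I) :
    remaining (n + 1) ω = (ω 0).1 * remaining n (shift ω) := by
  rw [remaining, Finset.prod_range_succ', mul_comm]
  rfl

theorem stick_succ (n : ℕ) (ω : ℕ → I × I) :
    stick (n + 1) ω = (ω 0).1 * stick n (shift ω) := by
  rw [stick, remaining_succ, stick, mul_assoc]
  rfl

theorem remaining_nonneg (n : ℕ) (ω : ℕ → I × I) : 0 ≤ remaining n ω :=
  Finset.prod_nonneg fun j _ => (ω j).1.2.1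

theorem stick_nonneg (n : ℕ) (ω : ℕ → I × I) : 0 ≤ stick n ω :=
  mul_nonneg (remaining_nonneg n ω) (sub_nonneg.2 (ω n).1.2.2)

/-- Telescoping: `stick k = remaining k - remaining (k + 1)`. -/
theorem sum_stick (n : ℕ) (ω : ℕ → I × I) :
    ∑ k ∈ Finset.range n, stick k ω = 1 - remaining n ω := by
  induction n with
  | zero => simp [remaining_zero]
  | succ n ih =>
    rw [Finset.sum_range_succ, ih, stick, remaining, remaining, Finset.prod_range_succ]
    ring

theorem summable_stick (ω : ℕ → I × I) : Summable fun k => stick k ω :=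
  summable_of_sum_range_le (c := 1) (fun k => stick_nonneg k ω) fun n => by
    rw [sum_stick]
    linarith [remaining_nonneg n ω]

theorem tsum_stick_le (ω : ℕ → I × I) : ∑' k, stick k ω ≤ 1 :=
  Real.tsum_le_of_sum_range_le (fun k => stick_nonneg k ω) fun n => by
    rw [sum_stick]
    linarith [remaining_nonneg n ω]

/-- The mass broken off at step `k`, if it is put into `[0,s]`. -/
def stickAt (k : ℕ) (ω : ℕ → I × I) (s : I) : ℝ := if (ω k).2 ≤ s then stick k ω else 0

theorem stickAt_nonneg (k : ℕ) (ω : ℕ → I × I) (s : I) : 0 ≤ stickAt k ω s := by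
  unfold stickAt
  split_ifs
  exacts [stick_nonneg k ω, le_rfl]

theorem stickAt_le (k : ℕ) (ω : ℕ → I × I) (s : I) : stickAt k ω s ≤ stick k ω := by
  unfold stickAt
  split_ifs
  exacts [le_rfl, stick_nonneg k ω]

theorem summable_stickAt (ω : ℕ → I × I) (s : I) : Summable fun k => stickAt k ω s :=
  (summable_stick ω).of_nonneg_of_le (fun k => stickAt_nonneg k ω s) fun k => stickAt_le k ω s

/-- The total mass put into `[0,s]`. -/
def stickSum (ω : ℕ → I × I) (s : I) : ℝ := ∑' k, stickAt k ω s

theorem stickSum_mem (ω : ℕ → I × I) (s : I) : stickSum ω s ∈ I :=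
  ⟨tsum_nonneg fun k => stickAt_nonneg k ω s,
    ((summable_stickAt ω s).tsum_le_tsum (fun k => stickAt_le k ω s) (summable_stick ω)).trans
      (tsum_stick_le ω)⟩

theorem stickSum_mono (ω : ℕ → I × I) {s t : I} (h : s ≤ t) : stickSum ω s ≤ stickSum ω t := by
  refine (summable_stickAt ω s).tsum_le_tsum (fun k => ?_) (summable_stickAt ω t)
  by_cases hk : (ω k).2 ≤ s
  · rw [stickAt, stickAt, if_pos hk, if_pos (hk.trans h)]
  · rw [stickAt, if_neg hk]
    exact stickAt_nonneg k ω t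

/-- The pathwise form of the fixed point equation: the first stick is split off, and the others form
a rescaled copy of the process. -/
theorem stickSum_shift (ω : ℕ → I × I) (s : I) :
    stickSum ω s = (1 - (ω 0).1) * (if (ω 0).2 ≤ s then 1 else 0) +
      (ω 0).1 * stickSum (shift ω) s := by
  rw [stickSum, (summable_stickAt ω s).tsum_eq_zero_add, stickSum, ← tsum_mul_left]
  congr 1
  · rw [stickAt, stick, remaining_zero, one_mul, mul_ite, mul_one, mul_zero]
  · refine tsum_congr fun k => ?_
    rw [stickAt, stickAt, stick_succ, mul_ite, mul_zero]
    rfl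

/-- Each summand is constant on some `[s, s')`, and the sticks dominate the series uniformly in the
argument. -/
theorem continuousWithinAt_stickSum (ω : ℕ → I × I) (s : I) :
    ContinuousWithinAt (stickSum ω) (Set.Ici s) s := by
  refine tendsto_tsum_of_dominated_convergence (summable_stick ω) (fun k => ?_)
    (Eventually.of_forall fun t k => ?_)
  · refine tendsto_const_nhds.congr' ?_
    by_cases hk : (ω k).2 ≤ s
    · filter_upwards [self_mem_nhdsWithin] with t ht
      rw [stickAt, stickAt, if_pos hk, if_pos (hk.trans ht)]
    · filter_upwards [mem_nhdsWithin_of_mem_nhds (Iio_mem_nhds (not_le.1 hk))] with t ht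
      rw [stickAt, stickAt, if_neg hk, if_neg (not_le.2 ht)]
  · rw [Real.norm_of_nonneg (stickAt_nonneg k ω t)]
    exact stickAt_le k ω t

theorem measurable_stick (k : ℕ) : Measurable (stick k) := by
  unfold stick remaining
  fun_prop

theorem measurable_stickSum : Measurable fun p : (ℕ → I × I) × I => stickSum p.1 p.2 := by
  refine measurable_of_tendsto_metrizable
    (f := fun n (p : (ℕ → I × I) × I) => ∑ k ∈ Finset.range n, stickAt k p.1 p.2) (fun n => ?_)
    (tendsto_pi_nhds.2 fun p => (summable_stickAt p.1 p.2).hasSum.tendsto_sum_nat)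
  refine Finset.measurable_fun_sum _ fun k _ => ?_
  refine Measurable.ite (measurableSet_le ?_ measurable_snd)
    ((measurable_stick k).comp measurable_fst) measurable_const
  fun_prop

/-- The random element of `𝒢₀` obtained by stick breaking. -/
def stickMap (ω : ℕ → I × I) : G0 where
  -- The sticks sum to `1` only when the remaining mass tends to `0`, so the value at `1` is
  -- prescribed.
  toFun s := if s = 1 then 1 else ⟨stickSum ω s, stickSum_mem ω s⟩
  monotone' s t h := by
    by_cases ht : t = 1
    · simp only [ht, if_true]
      exact unitInterval.le_one'
    · have hs : s ≠ 1 := fun hs => ht (le_antisymm unitInterval.le_one' (hs ▸ h))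
      simp only [ht, hs, if_false]
      exact stickSum_mono ω h
  rightCts' s := by
    by_cases hs : s = 1
    · subst hs
      have : Set.Ici (1 : I) = {1} :=
        Set.Subset.antisymm (fun t ht => le_antisymm unitInterval.le_one' ht) (by simp)
      rw [this]
      exact continuousWithinAt_singleton
    · have h : ContinuousWithinAt (fun t => (⟨stickSum ω t, stickSum_mem ω t⟩ : I)) (Set.Ici s) s :=
        tendsto_subtype_rng.2 (continuousWithinAt_stickSum ω s)
      refine h.congr_of_eventuallyEq ?_ (if_neg hs)
      filter_upwards [mem_nhdsWithin_of_mem_nhds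
        (Iio_mem_nhds (unitInterval.lt_one_iff_ne_one.2 hs))] with t ht
      exact if_neg (ne_of_lt ht)
  map_one' := if_pos rfl

theorem stickMap_apply (ω : ℕ → I × I) {s : I} (hs : s ≠ 1) :
    (stickMap ω s : ℝ) = stickSum ω s := by
  change ((if s = 1 then 1 else ⟨stickSum ω s, stickSum_mem ω s⟩ : I) : ℝ) = _
  rw [if_neg hs]

theorem measurable_stickMap : Measurable stickMap := by
  refine G0.measurable_of_uncurry ?_
  have h : (fun p : (ℕ → I × I) × I => (stickMap p.1 p.2 : ℝ)) =
      fun p => if p.2 = 1 then 1 else stickSum p.1 p.2 := by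
    funext p
    by_cases hp : p.2 = 1
    · rw [hp, (stickMap p.1).map_one', if_pos rfl, Set.Icc.coe_one]
    · rw [stickMap_apply _ hp, if_neg hp]
  rw [h]
  exact Measurable.ite (measurable_snd (measurableSet_singleton 1)) measurable_const
    measurable_stickSum

/-! ### Independent sequences -/

/-- Prepending a term to a sequence. -/
def seqCons {α : Type*} (p : α × (ℕ → α)) : ℕ → α
  | 0 => p.1
  | n + 1 => p.2 n

@[fun_prop]
theorem measurable_seqCons {α : Type*} [MeasurableSpace α] :
    Measurable (seqCons : α × (ℕ → α) → ℕ → α) :=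
  measurable_pi_iff.2 fun n => by
    cases n with
    | zero => exact measurable_fst
    | succ n => exact (measurable_pi_apply n).comp measurable_snd

theorem map_seqCons {α : Type*} [MeasurableSpace α] (ν : Measure α) [IsProbabilityMeasure ν] :
    (ν.prod (Measure.infinitePi fun _ : ℕ => ν)).map seqCons =
      Measure.infinitePi fun _ : ℕ => ν := by
  classical
  refine Measure.eq_infinitePi _ fun s t ht => ?_
  obtain ⟨n, hn⟩ := s.exists_nat_subset_range
  -- Padding the cylinder by full factors makes its index set the initial segment of length `n + 1`,
  -- which splits into `0` and a shifted range; the extra factors have measure one.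
  set t' : ℕ → Set α := fun i => if i ∈ s then t i else Set.univ with ht'
  have ht'm : ∀ i, MeasurableSet (t' i) := fun i => by
    simp only [ht']
    split_ifs
    exacts [ht i, .univ]
  have hpre : seqCons ⁻¹' Set.pi s t = t' 0 ×ˢ Set.pi (Finset.range n) fun i => t' (i + 1) := by
    ext p
    simp only [Set.mem_preimage, Set.mem_pi, Set.mem_prod, ht', Finset.mem_coe, Finset.mem_range]
    constructor
    · intro h
      refine ⟨?_, fun i _ => ?_⟩
      · split_ifs with h0
        exacts [h 0 h0, trivial]
      · split_ifs with h0
        exacts [h (i + 1) h0, trivial]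
    · rintro ⟨h0, h1⟩ i hi
      cases i with
      | zero => rwa [if_pos hi] at h0
      | succ i =>
        have := h1 i (Nat.lt_of_succ_lt (Finset.mem_range.1 (hn hi)))
        rwa [if_pos hi] at this
  rw [Measure.map_apply measurable_seqCons (.pi s.countable_toSet fun i _ => ht i), hpre,
    Measure.prod_prod, Measure.infinitePi_pi _ fun i _ => ht'm _, mul_comm,
    ← Finset.prod_range_succ' (fun i => ν (t' i)), ← Finset.prod_subset
      (hn.trans (Finset.range_mono n.le_succ))]
  · exact Finset.prod_congr rfl fun i hi => by simp only [ht', if_pos hi]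
  · intro i _ hi
    simp only [ht', if_neg hi, measure_univ]

theorem lintegral_infinitePi_eq_seqCons {α : Type*} [MeasurableSpace α] (ν : Measure α)
    [IsProbabilityMeasure ν] {f : (ℕ → α) → ℝ≥0∞} (hf : Measurable f) :
    ∫⁻ ω, f ω ∂(Measure.infinitePi fun _ : ℕ => ν) =
      ∫⁻ a, ∫⁻ ω, f (seqCons (a, ω)) ∂(Measure.infinitePi fun _ : ℕ => ν) ∂ν := by
  conv_lhs => rw [← map_seqCons ν, lintegral_map hf measurable_seqCons]
  exact lintegral_prod _ (hf.comp measurable_seqCons).aemeasurable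

/-- The law of the stick breaking data. -/
def stickLaw (β : ℝ) : Measure (ℕ → I × I) :=
  Measure.infinitePi fun _ => (radiusLaw β).prod volume

/-! ### The marginals of the stick breaking process -/

/-- Iterated stick breaking, on the level of `(x₁,…,x_N)`. -/
def stickIter {N : ℕ} (T : Partition N) : ℕ → (ℕ → I × I) × (Fin N → ℝ) → Fin N → ℝ
  | 0, p => p.2
  -- The step with `ω 0` stays outermost and new steps enter innermost, so the iterates converge for
  -- fixed `ω` instead of merely keeping their law.
  | n + 1, p => stickStep T (p.1 0, stickIter T n (shift p.1, p.2))

@[fun_prop]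
theorem measurable_shift {α : Type*} [MeasurableSpace α] :
    Measurable (shift : (ℕ → α) → ℕ → α) :=
  measurable_pi_iff.2 fun n => measurable_pi_apply (n + 1)

@[fun_prop]
theorem measurable_stickIter {N : ℕ} (T : Partition N) (n : ℕ) : Measurable (stickIter T n) := by
  induction n with
  | zero => exact measurable_snd
  | succ n ih =>
    change Measurable fun p : (ℕ → I × I) × (Fin N → ℝ) =>
      stickStep T (p.1 0, stickIter T n (shift p.1, p.2))
    fun_prop

theorem measurable_remaining (n : ℕ) : Measurable (remaining n) := by
  unfold remaining
  fun_prop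

theorem isProbabilityMeasure_stickLaw {β : ℝ} (hβ : 0 < β) : IsProbabilityMeasure (stickLaw β) := by
  have := isProbabilityMeasure_radiusLaw hβ
  unfold stickLaw
  infer_instance

theorem lintegral_stickLaw {β : ℝ} (hβ : 0 < β) {f : (ℕ → I × I) → ℝ≥0∞} (hf : Measurable f) :
    ∫⁻ ω, f ω ∂(stickLaw β) =
      ∫⁻ a, ∫⁻ ω, f (seqCons (a, ω)) ∂(stickLaw β) ∂((radiusLaw β).prod volume) :=
  have := isProbabilityMeasure_radiusLaw hβ
  lintegral_infinitePi_eq_seqCons _ hf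

theorem lintegral_remaining {β : ℝ} (hβ : 0 < β) (n : ℕ) :
    ∫⁻ ω, ENNReal.ofReal (remaining n ω) ∂(stickLaw β) = ENNReal.ofReal (β / (β + 1)) ^ n := by
  have := isProbabilityMeasure_radiusLaw hβ
  have := isProbabilityMeasure_stickLaw hβ
  induction n with
  | zero => simp [remaining_zero]
  | succ n ih =>
    have h : ∀ (a : I × I) (ω : ℕ → I × I), ENNReal.ofReal (remaining (n + 1) (seqCons (a, ω))) =
        ENNReal.ofReal a.1 * ENNReal.ofReal (remaining n ω) := fun a ω => by
      rw [remaining_succ, ENNReal.ofReal_mul (seqCons (a, ω) 0).1.2.1]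
      rfl
    rw [lintegral_stickLaw hβ (measurable_remaining _).ennreal_ofReal]
    simp_rw [h, lintegral_const_mul' _ _ ENNReal.ofReal_ne_top, ih]
    rw [lintegral_mul_const _ (by fun_prop), lintegral_prod _ (by fun_prop)]
    simp only [lintegral_const, measure_univ, mul_one]
    rw [lintegral_radiusLaw_id hβ, pow_succ, mul_comm]

/-- The expectations form a geometric series of ratio `β / (β + 1) < 1`, so `∑ₙ remaining n` is
almost surely finite. -/
theorem ae_tendsto_remaining {β : ℝ} (hβ : 0 < β) :
    ∀ᵐ ω ∂(stickLaw β), Tendsto (fun n => remaining n ω) atTop (𝓝 0) := by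
  have hfin : ∫⁻ ω, ∑' n, ENNReal.ofReal (remaining n ω) ∂(stickLaw β) ≠ ∞ := by
    rw [lintegral_tsum fun n => (measurable_remaining n).ennreal_ofReal.aemeasurable]
    simp_rw [lintegral_remaining hβ]
    rw [ENNReal.tsum_geometric, ENNReal.inv_ne_top]
    refine (tsub_pos_of_lt (ENNReal.ofReal_lt_one.2 ?_)).ne'
    rw [div_lt_one (by linarith)]
    linarith
  filter_upwards [ae_lt_top (Measurable.tsum fun n => (measurable_remaining n).ennreal_ofReal)
    hfin] with ω hω
  have h := (ENNReal.tendsto_toReal ENNReal.zero_ne_top).comp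
    (ENNReal.tendsto_atTop_zero_of_tsum_ne_top hω.ne)
  simpa [Function.comp_def, ENNReal.toReal_ofReal (remaining_nonneg _ _)] using h

theorem map_stickIter {β : ℝ} (hβ : 0 < β) {N : ℕ} (T : Partition N) (n : ℕ) :
    ((stickLaw β).prod (dirichletLaw β T)).map (stickIter T n) = dirichletLaw β T := by
  have : IsProbabilityMeasure (dirichletLaw β T) := ⟨dirichletLaw_univ hβ T⟩
  have := isProbabilityMeasure_radiusLaw hβ
  have := isProbabilityMeasure_stickLaw hβ
  induction n with
  | zero =>
    change Measure.map Prod.snd _ = _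
    rw [Measure.map_snd_prod, measure_univ, one_smul]
  | succ n ih =>
    refine Measure.ext_of_lintegral _ fun f hf => ?_
    have hm : Measurable fun p => f (stickIter T (n + 1) p) := by fun_prop
    have h : ∀ a : I × I, ∫⁻ ω, ∫⁻ x, f (stickIter T (n + 1) (seqCons (a, ω), x))
        ∂(dirichletLaw β T) ∂(stickLaw β) =
        ∫⁻ x, f (stickStep T (a, x)) ∂(dirichletLaw β T) := by
      intro a
      have hm' : Measurable fun x => f (stickStep T (a, x)) := by fun_prop
      have hm2 : Measurable fun p => f (stickStep T (a, stickIter T n p)) := by fun_prop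
      conv_rhs => rw [← ih, lintegral_map hm' (by fun_prop), lintegral_prod _ hm2.aemeasurable]
      rfl
    rw [lintegral_map hf (by fun_prop), lintegral_prod _ hm.aemeasurable,
      lintegral_stickLaw hβ hm.lintegral_prod_right']
    simp_rw [h]
    have hm3 : Measurable fun p => f (stickStep T p) := by fun_prop
    conv_rhs => rw [← map_stickStep hβ T, lintegral_map hf (by fun_prop),
      lintegral_prod _ hm3.aemeasurable]

/-- Both quantities obey the same affine recursion, so each step multiplies the difference by `(ω
0).1`. The initial difference is at most `|x i| + 1` because `stickSum` lies in `[0,1]`. -/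
theorem abs_stickIter_sub_le {N : ℕ} (T : Partition N) (n : ℕ) (ω : ℕ → I × I) (x : Fin N → ℝ)
    (i : Fin N) : |stickIter T n (ω, x) i - stickSum ω (T.t i.castSucc.succ)| ≤
      remaining n ω * (|x i| + 1) := by
  induction n generalizing ω with
  | zero =>
    rw [remaining_zero, one_mul]
    refine (abs_sub _ _).trans (add_le_add le_rfl ?_)
    rw [abs_of_nonneg (stickSum_mem _ _).1]
    exact (stickSum_mem _ _).2
  | succ n ih =>
    rw [stickSum_shift, remaining_succ]
    have h : stickIter T (n + 1) (ω, x) i = (1 - (ω 0).1) *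
        (if (ω 0).2 ≤ T.t i.castSucc.succ then 1 else 0) +
        (ω 0).1 * stickIter T n (shift ω, x) i := rfl
    rw [h, add_sub_add_left_eq_sub, ← mul_sub, abs_mul, abs_of_nonneg (ω 0).1.2.1, mul_assoc]
    exact mul_le_mul_of_nonneg_left (ih _) (ω 0).1.2.1

/-- The marginals of the stick breaking process are the Dirichlet distributions. -/
theorem map_stickSum {β : ℝ} (hβ : 0 < β) {N : ℕ} (T : Partition N) :
    (stickLaw β).map (fun ω i => stickSum ω (T.t (Fin.succ (Fin.castSucc i)))) =
      dirichletLaw β T := by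
  have : IsProbabilityMeasure (dirichletLaw β T) := ⟨dirichletLaw_univ hβ T⟩
  have := isProbabilityMeasure_stickLaw hβ
  have hms : Measurable fun (ω : ℕ → I × I) (i : Fin N) =>
      stickSum ω (T.t (Fin.succ (Fin.castSucc i))) :=
    measurable_pi_iff.2 fun i => measurable_stickSum.comp measurable_prodMk_right
  have := Measure.isProbabilityMeasure_map (μ := stickLaw β) hms.aemeasurable
  refine ext_of_forall_integral_eq_of_IsFiniteMeasure fun f => ?_
  -- The iterates all have the Dirichlet law and converge almost surely to the stick sums, whatever
  -- the starting vector; the limit therefore has the same law.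
  have hlim : Tendsto (fun n => ∫ p, f (stickIter T n p) ∂((stickLaw β).prod (dirichletLaw β T)))
      atTop (𝓝 (∫ p, f (fun i => stickSum p.1 (T.t (Fin.succ (Fin.castSucc i))))
        ∂((stickLaw β).prod (dirichletLaw β T)))) := by
    refine tendsto_integral_of_dominated_convergence (fun _ => ‖f‖)
      (fun n => (f.continuous.measurable.comp (measurable_stickIter T n)).aestronglyMeasurable)
      (integrable_const _) (fun n => Eventually.of_forall fun p => f.norm_coe_le_norm _) ?_
    filter_upwards [Measure.quasiMeasurePreserving_fst.ae (ae_tendsto_remaining hβ)] with p hp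
    refine (f.continuous.tendsto _).comp (tendsto_pi_nhds.2 fun i => ?_)
    rw [tendsto_iff_norm_sub_tendsto_zero]
    refine squeeze_zero (fun _ => norm_nonneg _) (fun n => abs_stickIter_sub_le T n p.1 p.2 i) ?_
    simpa using hp.mul_const (|p.2 i| + 1)
  have hconst : ∀ n, ∫ p, f (stickIter T n p) ∂((stickLaw β).prod (dirichletLaw β T)) =
      ∫ x, f x ∂(dirichletLaw β T) := fun n => by
    conv_rhs => rw [← map_stickIter hβ T n]
    exact (integral_map (measurable_stickIter T n).aemeasurable
      f.continuous.measurable.aestronglyMeasurable).symm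
  simp_rw [hconst] at hlim
  rw [integral_map hms.aemeasurable f.continuous.measurable.aestronglyMeasurable,
    tendsto_nhds_unique tendsto_const_nhds hlim,
    integral_fun_fst (fun ω => f fun i => stickSum ω (T.t (Fin.succ (Fin.castSucc i))))]
  simp

/-! ### The finite dimensional marginals -/

/-- The vector `(g t₁,…,g t_N)`. -/
def coords {N : ℕ} (T : Partition N) (g : G0) (i : Fin N) : ℝ := g (T.t i.castSucc.succ)

theorem measurable_coords {N : ℕ} (T : Partition N) : Measurable (coords T) :=
  measurable_pi_iff.2 fun _ => G0.measurable_eval _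

theorem map_coords_of_hasDirichletMarginals {β : ℝ} (hβ : 0 < β) {Q : Measure G0}
    [IsProbabilityMeasure Q] (hQ : HasDirichletMarginals β Q) {N : ℕ} (T : Partition N) :
    Q.map (coords T) = dirichletLaw β T := by
  have : IsProbabilityMeasure (dirichletLaw β T) := ⟨dirichletLaw_univ hβ T⟩
  have := Measure.isProbabilityMeasure_map (μ := Q) (measurable_coords T).aemeasurable
  refine Measure.ext fun s hs => ?_
  have hms : Measurable (s.indicator fun _ => (1 : ℝ)) := measurable_const.indicator hs
  have h := hQ N T (s.indicator fun _ => 1) hms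
    ⟨1, fun x => by by_cases hx : x ∈ s <;> simp [hx]⟩
  rw [← integral_partitionMeasure hβ,
    ← PartitionSpace.measurableEmbedding_val.integral_map] at h
  have h' := integral_map (μ := Q) (measurable_coords T).aemeasurable hms.aestronglyMeasurable
  rw [← (measureReal_eq_measureReal_iff), ← integral_indicator_one hs, ← integral_indicator_one hs]
  exact h'.trans h

theorem hasDirichletMarginals_of_map_coords {β : ℝ} (hβ : 0 < β) {Q : Measure G0}
    (hQ : ∀ (N : ℕ) (T : Partition N), Q.map (coords T) = dirichletLaw β T) :
    HasDirichletMarginals β Q := by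
  intro N T u hu _
  rw [← integral_partitionMeasure hβ,
    ← PartitionSpace.measurableEmbedding_val.integral_map]
  have h := integral_map (μ := Q) (measurable_coords T).aemeasurable
    hu.aestronglyMeasurable
  rw [hQ] at h
  exact h.symm

/-- The entropic measure. -/
def entropicMeasure (β : ℝ) : Measure G0 := (stickLaw β).map stickMap

theorem isProbabilityMeasure_entropicMeasure {β : ℝ} (hβ : 0 < β) :
    IsProbabilityMeasure (entropicMeasure β) :=
  have := isProbabilityMeasure_stickLaw hβ
  Measure.isProbabilityMeasure_map measurable_stickMap.aemeasurable

theorem hasDirichletMarginals_entropicMeasure {β : ℝ} (hβ : 0 < β) :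
    HasDirichletMarginals β (entropicMeasure β) := by
  refine hasDirichletMarginals_of_map_coords hβ fun N T => ?_
  rw [entropicMeasure, Measure.map_map (measurable_coords T) measurable_stickMap,
    ← map_stickSum hβ T]
  congr 1
  funext ω i
  refine stickMap_apply ω (ne_of_lt ?_)
  rw [← T.t_last, ← Fin.succ_last]
  exact T.strictMono (Fin.succ_lt_succ_iff.2 (Fin.castSucc_lt_last i))

/-! ### Step functions -/

theorem G0.ofReal_dist_sq (g h : G0) :
    ENNReal.ofReal (dist g h ^ 2) = ∫⁻ s : I, ENNReal.ofReal (((g s : ℝ) - (h s : ℝ)) ^ 2) := by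
  rw [G0.dist_sq]
  refine ofReal_integral_eq_lintegral_ofReal ?_ (Eventually.of_forall fun s => sq_nonneg _)
  exact (g.memLp.sub h.memLp).integrable_sq

theorem dist_stepMap {N : ℕ} (T : Partition N) (x y : PartitionSpace T) :
    dist (stepMap T x) (stepMap T y) = dist x y := by
  have h := G0.ofReal_dist_sq (stepMap T x) (stepMap T y)
  rw [T.lintegral_of_eq_on_Ico _ (fun i => ENNReal.ofReal
    ((extend x.val i.castSucc - extend y.val i.castSucc) ^ 2)) fun i s hs => by
      change ENNReal.ofReal ((stepValue T x s - stepValue T y s) ^ 2) = _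
      rw [stepValue_eq T x i s hs.1 hs.2, stepValue_eq T y i s hs.1 hs.2]] at h
  simp_rw [← ENNReal.ofReal_mul (T.gap_pos _).le] at h
  rw [← ENNReal.ofReal_sum_of_nonneg fun i _ => mul_nonneg (T.gap_pos i).le (sq_nonneg _),
    ENNReal.ofReal_eq_ofReal_iff (sq_nonneg _) (Finset.sum_nonneg
      fun i _ => mul_nonneg (T.gap_pos i).le (sq_nonneg _)), Fin.sum_univ_succ] at h
  rw [PartitionSpace.dist_def, ← Real.sqrt_sq (dist_nonneg (x := stepMap T x)), h]
  congr 1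
  -- The cell `[t₀, t₁)` drops out: both step functions vanish there.
  simp only [Fin.castSucc_zero, extend_zero, sub_self, ne_eq, OfNat.ofNat_ne_zero,
    not_false_eq_true, zero_pow, mul_zero, zero_add]
  refine Finset.sum_congr rfl fun i _ => ?_
  have hx : ∀ z : Fin N → ℝ, extend z i.succ.castSucc = z i := fun z => by
    rw [← Fin.succ_castSucc]
    simp [extend]
  rw [hx, hx, sq_abs, abs_of_pos (T.gap_pos _), mul_comm]

theorem measurable_stepMap {N : ℕ} (T : Partition N) : Measurable (stepMap T) :=
  (Isometry.of_dist_eq (dist_stepMap T)).continuous.measurable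

theorem extend_coords_succ {N : ℕ} (T : Partition N) (g : G0) (j : Fin (N + 1)) :
    extend (coords T g) j.succ = g (T.t j.succ) := by
  refine Fin.lastCases ?_ (fun k => ?_) j
  · rw [Fin.succ_last, extend_last, T.t_last, g.map_one', Set.Icc.coe_one]
  · simp [extend, coords]

/-- Only an inequality, since `g 0` may be positive while the adjoined value `x₀` is `0`. -/
theorem extend_coords_le {N : ℕ} (T : Partition N) (g : G0) (k : Fin (N + 2)) :
    extend (coords T g) k ≤ g (T.t k) := by
  refine Fin.cases ?_ (fun j => ?_) k
  · rw [extend_zero]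
    exact (g _).2.1
  · rw [extend_coords_succ]

/-- On each cell `0 ≤ g - xᵢ ≤ x_{i+1} - xᵢ ≤ 1`, so the squared difference is at most the
increment; the increments sum to `1`, and each cell has length at most `δ`. -/
theorem dist_stepMap_coords_sq_le {N : ℕ} (T : Partition N) {δ : ℝ} (hδ : ∀ i, T.gap i ≤ δ)
    (g : G0) (hg : coords T g ∈ Simplex N) :
    dist g (stepMap T ⟨coords T g, hg⟩) ^ 2 ≤ δ := by
  have hpos := (mem_simplex_iff _).1 hg
  have hδ0 : 0 ≤ δ := (T.gap_pos 0).le.trans (hδ 0)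
  have h : ∀ i, ∀ s ∈ Set.Ico (T.t i.castSucc) (T.t i.succ),
      ENNReal.ofReal (((g s : ℝ) - (stepMap T ⟨coords T g, hg⟩ s : ℝ)) ^ 2) ≤
        ENNReal.ofReal (increment (coords T g) i) := by
    intro i s hs
    refine ENNReal.ofReal_le_ofReal ?_
    have h1 : (stepMap T ⟨coords T g, hg⟩ s : ℝ) = extend (coords T g) i.castSucc :=
      stepValue_eq T ⟨coords T g, hg⟩ i s hs.1 hs.2
    have h2 := (extend_coords_le T g i.castSucc).trans (g.coe_mono hs.1)
    have h3 := g.coe_mono hs.2.le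
    rw [← extend_coords_succ] at h3
    have h4 := increment_le_one hg i
    rw [increment] at h4 ⊢
    rw [h1]
    nlinarith
  refine (ENNReal.ofReal_le_ofReal_iff hδ0).1 ?_
  rw [G0.ofReal_dist_sq]
  refine (T.lintegral_le_of_le_on_Ico _ _ h).trans ?_
  calc ∑ i, ENNReal.ofReal (T.gap i) * ENNReal.ofReal (increment (coords T g) i)
      ≤ ∑ i, ENNReal.ofReal δ * ENNReal.ofReal (increment (coords T g) i) := by
        gcongr with i
        exact hδ i
    _ = ENNReal.ofReal δ := by
        rw [← Finset.mul_sum, ← ENNReal.ofReal_sum_of_nonneg fun i _ => (hpos i).le,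
          sum_increment, ENNReal.ofReal_one, mul_one]

instance : Inhabited G0 :=
  ⟨⟨fun _ => 1, monotone_const, fun _ => continuousWithinAt_const, rfl⟩⟩

/-- The step function with the same values as `g` at the points of the partition, provided that
these values are strictly increasing. -/
def discretize {N : ℕ} (T : Partition N) (g : G0) : G0 :=
  -- The default serves only to make the map total; it is used on a null set, by
  -- `ae_coords_mem_simplex`.
  Function.extend PartitionSpace.val (stepMap T) (fun _ => default) (coords T g)

theorem discretize_of_mem {N : ℕ} (T : Partition N) {g : G0} (hg : coords T g ∈ Simplex N) :
    discretize T g = stepMap T ⟨coords T g, hg⟩ :=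
  PartitionSpace.val_injective.extend_apply (stepMap T) (fun _ => default) ⟨coords T g, hg⟩

theorem measurable_extend_stepMap {N : ℕ} (T : Partition N) : Measurable
    (Function.extend PartitionSpace.val (stepMap T) (fun _ => default)) :=
  PartitionSpace.measurableEmbedding_val.measurable_extend (measurable_stepMap T) measurable_const

theorem measurable_discretize {N : ℕ} (T : Partition N) : Measurable (discretize T) :=
  (measurable_extend_stepMap T).comp (measurable_coords T)

section Marginals

variable {β : ℝ} {Q : Measure G0} [IsProbabilityMeasure Q]

/-- The discretisation sees `g` only through its Dirichlet distributed coordinates. Thus `(f^T)_*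
μ_T` is realised on the probability space of `Q`, coupled with `g` itself. -/
theorem map_discretize (hβ : 0 < β) (hQ : HasDirichletMarginals β Q) {N : ℕ} (T : Partition N) :
    Q.map (discretize T) = (partitionMeasure β T).map (stepMap T) := by
  have h : discretize T =
    Function.extend PartitionSpace.val (stepMap T) (fun _ => default) ∘ coords T := rfl
  rw [h, ← Measure.map_map (measurable_extend_stepMap T) (measurable_coords T),
    map_coords_of_hasDirichletMarginals hβ hQ, dirichletLaw,
    Measure.map_map (measurable_extend_stepMap T) PartitionSpace.measurableEmbedding_val.measurable,
    Function.extend_comp PartitionSpace.val_injective]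

theorem ae_coords_mem_simplex (hβ : 0 < β) (hQ : HasDirichletMarginals β Q) {N : ℕ}
    (T : Partition N) : ∀ᵐ g ∂Q, coords T g ∈ Simplex N := by
  rw [← ae_map_iff (p := (· ∈ Simplex N)) (measurable_coords T).aemeasurable
      (measurableSet_simplex N),
    map_coords_of_hasDirichletMarginals hβ hQ, dirichletLaw,
    ae_map_iff (p := (· ∈ Simplex N)) PartitionSpace.measurableEmbedding_val.measurable.aemeasurable
      (measurableSet_simplex N)]
  exact Eventually.of_forall fun x => x.mem

theorem ae_dist_discretize_sq_le (hβ : 0 < β) (hQ : HasDirichletMarginals β Q) {N : ℕ}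
    (T : Partition N) {δ : ℝ} (hδ : ∀ i, T.gap i ≤ δ) :
    ∀ᵐ g ∂Q, dist g (discretize T g) ^ 2 ≤ δ := by
  filter_upwards [ae_coords_mem_simplex hβ hQ T] with g hg
  rw [discretize_of_mem T hg]
  exact dist_stepMap_coords_sq_le T hδ g hg

end Marginals

/-! ### The standard partitions -/

theorem gap_std (N : ℕ) (i : Fin (2 ^ N - 1 + 1)) : (Partition.std N).gap i = (2 ^ N)⁻¹ := by
  simp only [Partition.gap, Partition.std, Fin.val_succ, Fin.val_castSucc]
  push_cast
  ring

/-- The accuracy of the approximation by step functions. -/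
def stdError (N : ℕ) : ℝ := √((2 ^ N)⁻¹)

theorem stdError_pos (N : ℕ) : 0 < stdError N := Real.sqrt_pos.2 (by positivity)

theorem stdError_le_one (N : ℕ) : stdError N ≤ 1 :=
  Real.sqrt_le_one.2 (inv_le_one_of_one_le₀ (one_le_pow₀ one_le_two))

theorem tendsto_stdError : Tendsto stdError atTop (𝓝 0) := by
  have h : Tendsto (fun N : ℕ => ((2 : ℝ) ^ N)⁻¹) atTop (𝓝 0) :=
    tendsto_inv_atTop_zero.comp (tendsto_pow_atTop_atTop_of_one_lt one_lt_two)
  have h' := h.sqrt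
  rwa [Real.sqrt_zero] at h'

theorem ae_dist_discretize_std_le {β : ℝ} {Q : Measure G0} [IsProbabilityMeasure Q] (hβ : 0 < β)
    (hQ : HasDirichletMarginals β Q) (N : ℕ) :
    ∀ᵐ g ∂Q, dist g (discretize (Partition.std N) g) ≤ stdError N := by
  filter_upwards [ae_dist_discretize_sq_le hβ hQ (Partition.std N) fun i => (gap_std N i).le]
    with g hg
  exact Real.le_sqrt_of_sq_le hg

theorem tendsto_integral_stepMap {β : ℝ} {Q : Measure G0} [IsProbabilityMeasure Q] (hβ : 0 < β)
    (hQ : HasDirichletMarginals β Q) (f : G0 →ᵇ ℝ) :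
    Tendsto (fun N => ∫ g, f g ∂((partitionMeasure β (Partition.std N)).map
      (stepMap (Partition.std N)))) atTop (𝓝 (∫ g, f g ∂Q)) := by
  simp_rw [← map_discretize hβ hQ, integral_map (measurable_discretize _).aemeasurable
    f.continuous.measurable.aestronglyMeasurable]
  refine tendsto_integral_of_dominated_convergence (fun _ => ‖f‖)
    (fun n => (f.continuous.measurable.comp (measurable_discretize _)).aestronglyMeasurable)
    (integrable_const _) (fun n => Eventually.of_forall fun g => f.norm_coe_le_norm _) ?_
  filter_upwards [ae_all_iff.2 (ae_dist_discretize_std_le hβ hQ)] with g hg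
  refine (f.continuous.tendsto g).comp (tendsto_iff_dist_tendsto_zero.2 ?_)
  refine squeeze_zero (fun _ => dist_nonneg) (fun N => ?_) tendsto_stdError
  rw [dist_comm]
  exact hg N

/-- Both measures are weak limits of one sequence, which involves neither of them. -/
theorem HasDirichletMarginals.unique {β : ℝ} (hβ : 0 < β) {Q Q' : Measure G0}
    [IsProbabilityMeasure Q] [IsProbabilityMeasure Q'] (hQ : HasDirichletMarginals β Q)
    (hQ' : HasDirichletMarginals β Q') : Q = Q' :=
  ext_of_forall_integral_eq_of_IsFiniteMeasure fun f =>
    tendsto_nhds_unique (tendsto_integral_stepMap hβ hQ f) (tendsto_integral_stepMap hβ hQ' f)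

/-! ### Wasserstein convergence -/

/-- The joint law of `f` and `h` is a transport plan. -/
theorem wassersteinDist_map_le {Ω X : Type*} [MeasurableSpace Ω] [MetricSpace X]
    [SecondCountableTopology X] [MeasurableSpace X] [BorelSpace X] {P : Measure Ω}
    [IsProbabilityMeasure P] {f h : Ω → X} (hf : Measurable f) (hh : Measurable h) {c : ℝ≥0∞}
    (hc : ∀ᵐ ω ∂P, edist (f ω) (h ω) ≤ c) :
    wassersteinDist (P.map f) (P.map h) ≤ c := by
  have hfh : Measurable fun ω => (f ω, h ω) := hf.prodMk hh
  have hle : ⨅ π ∈ {π : Measure (X × X) | π.map Prod.fst = P.map f ∧ π.map Prod.snd = P.map h},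
      ∫⁻ p, edist p.1 p.2 ^ 2 ∂π ≤ c ^ 2 := by
    refine (iInf₂_le (P.map fun ω => (f ω, h ω)) 
      ⟨Measure.map_map measurable_fst hfh, Measure.map_map measurable_snd hfh⟩).trans ?_
    rw [lintegral_map (measurable_edist.pow_const 2) hfh]
    calc ∫⁻ ω, edist (f ω) (h ω) ^ 2 ∂P ≤ ∫⁻ _, c ^ 2 ∂P :=
          lintegral_mono_ae (hc.mono fun ω hω => by gcongr)
      _ = c ^ 2 := by simp
  calc wassersteinDist (P.map f) (P.map h) ≤ (c ^ 2) ^ (1 / 2 : ℝ) :=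
        ENNReal.rpow_le_rpow hle (by norm_num)
    _ = c := by rw [← ENNReal.rpow_natCast, ← ENNReal.rpow_mul]; norm_num

section

variable {β : ℝ} {Q : Measure G0} [IsProbabilityMeasure Q]

theorem wassersteinDist_stepMap_stepMap_le (hβ : 0 < β) (hQ : HasDirichletMarginals β Q)
    (M N : ℕ) : wassersteinDist
      ((partitionMeasure β (Partition.std M)).map (stepMap (Partition.std M)))
      ((partitionMeasure β (Partition.std N)).map (stepMap (Partition.std N))) ≤
      ENNReal.ofReal (stdError M + stdError N) := by
  rw [← map_discretize hβ hQ, ← map_discretize hβ hQ]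
  refine wassersteinDist_map_le (measurable_discretize _) (measurable_discretize _) ?_
  filter_upwards [ae_dist_discretize_std_le hβ hQ M, ae_dist_discretize_std_le hβ hQ N]
    with g h1 h2
  rw [edist_dist]
  refine ENNReal.ofReal_le_ofReal ((dist_triangle_left _ _ g).trans (add_le_add h1 h2))

theorem wassersteinDist_stepMap_le (hβ : 0 < β) (hQ : HasDirichletMarginals β Q) (N : ℕ) :
    wassersteinDist ((partitionMeasure β (Partition.std N)).map (stepMap (Partition.std N))) Q ≤
      ENNReal.ofReal (stdError N) := by
  have h := wassersteinDist_map_le (P := Q) (c := ENNReal.ofReal (stdError N))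
    (measurable_discretize (Partition.std N)) measurable_id ?_
  · rwa [map_discretize hβ hQ, Measure.map_id] at h
  · filter_upwards [ae_dist_discretize_std_le hβ hQ N] with g hg
    rw [edist_dist, dist_comm]
    exact ENNReal.ofReal_le_ofReal hg

end

/-! ### Approximation of all of `𝒢₀` -/

/-- The convex combination of `g` with the identity. -/
def mixId (δ : I) (g : G0) : G0 where
  toFun s := ⟨(1 - (δ : ℝ)) * g s + δ * s, convex_Icc (0 : ℝ) 1 (g s).2 s.2
    (sub_nonneg.2 δ.2.2) δ.2.1 (by ring)⟩
  monotone' s t h := Subtype.coe_le_coe.1 <| add_le_add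
    (mul_le_mul_of_nonneg_left (g.coe_mono h) (sub_nonneg.2 δ.2.2))
    (mul_le_mul_of_nonneg_left h δ.2.1)
  rightCts' s := tendsto_subtype_rng.2 <|
    ((continuous_subtype_val.continuousAt.comp_continuousWithinAt (g.rightCts' s)).const_mul _).add
      (continuous_subtype_val.continuousWithinAt.const_mul _)
  map_one' := by
    ext
    simp [g.map_one']

theorem mixId_apply (δ : I) (g : G0) (s : I) :
    (mixId δ g s : ℝ) = (1 - (δ : ℝ)) * g s + δ * s := rfl

theorem dist_mixId_le (δ : I) (g : G0) : dist g (mixId δ g) ≤ δ := by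
  refine le_of_sq_le_sq ?_ δ.2.1
  rw [G0.dist_sq]
  have h : ∀ s : I, ((g s : ℝ) - (mixId δ g s : ℝ)) ^ 2 ≤ (δ : ℝ) ^ 2 := by
    intro s
    rw [mixId_apply, show (g s : ℝ) - ((1 - (δ : ℝ)) * g s + δ * s) = δ * (g s - s) by ring,
      mul_pow]
    refine mul_le_of_le_one_right (sq_nonneg _) ?_
    have h1 := (g s).2.1
    have h2 := (g s).2.2
    have h3 := s.2.1
    have h4 := s.2.2
    rw [sq_le_one_iff_abs_le_one, abs_le]
    constructor <;> linarith
  refine (integral_mono_of_nonneg (Eventually.of_forall fun s => sq_nonneg _)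
    (integrable_const ((δ : ℝ) ^ 2)) (Eventually.of_forall h)).trans ?_
  simp

/-- A general `g` may be constant between partition points and so leave the open simplex; adding a
multiple of the identity makes it strictly increasing. -/
theorem coords_mixId_mem {δ : I} (hδ : 0 < δ) (g : G0) {N : ℕ} (T : Partition N) :
    coords T (mixId δ g) ∈ Simplex N := by
  refine (mem_simplex_iff _).2 fun i => ?_
  rw [increment, extend_coords_succ]
  refine sub_pos.2 ((extend_coords_le T _ _).trans_lt ?_)
  rw [mixId_apply, mixId_apply]
  have hlt := T.strictMono i.castSucc_lt_succ
  exact add_lt_add_of_le_of_lt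
    (mul_le_mul_of_nonneg_left (g.coe_mono hlt.le) (sub_nonneg.2 δ.2.2))
    (mul_lt_mul_of_pos_left (Subtype.coe_lt_coe.2 hlt) (Subtype.coe_lt_coe.2 hδ))

theorem isEpsIsometry_stepMap_std (N : ℕ) :
    IsEpsIsometry (2 * stdError N) (stepMap (Partition.std N)) := by
  refine ⟨fun x y => ?_, fun g => ?_⟩
  · rw [dist_stepMap, sub_self, abs_zero]
    exact mul_nonneg zero_le_two (stdError_pos N).le
  -- One `stdError` is spent on mixing with the identity and one on discretising, hence the factor
  -- `2`.
  · let δ : I := ⟨stdError N, (stdError_pos N).le, stdError_le_one N⟩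
    have hmem := coords_mixId_mem (δ := δ) (Subtype.coe_lt_coe.1 (stdError_pos N)) g
      (Partition.std N)
    refine ⟨⟨_, hmem⟩, (dist_triangle _ (mixId δ g) _).trans ?_⟩
    rw [two_mul]
    exact add_le_add (dist_mixId_le δ g) (Real.le_sqrt_of_sq_le
      (dist_stepMap_coords_sq_le _ (fun i => (gap_std N i).le) _ hmem))

end EntropicMeasure

end

theorem mainTheorem5 (β : ℝ) (hβ : 0 < β) :
    (∀ (N : ℕ) (T : EntropicMeasure.Partition N),
      IsProbabilityMeasure (EntropicMeasure.partitionMeasure β T)) ∧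
    ∃ Q : ProbabilityMeasure EntropicMeasure.G0,
      EntropicMeasure.HasDirichletMarginals β (Q : Measure EntropicMeasure.G0) ∧
      (∀ Q' : ProbabilityMeasure EntropicMeasure.G0,
        EntropicMeasure.HasDirichletMarginals β (Q' : Measure EntropicMeasure.G0) → Q' = Q) ∧
      (∀ ε : ENNReal, 0 < ε → ∃ N₀ : ℕ, ∀ M N : ℕ, N₀ ≤ M → N₀ ≤ N →
        EntropicMeasure.wassersteinDist
          (Measure.map (EntropicMeasure.stepMap (EntropicMeasure.Partition.std M))
            (EntropicMeasure.partitionMeasure β (EntropicMeasure.Partition.std M)))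
          (Measure.map (EntropicMeasure.stepMap (EntropicMeasure.Partition.std N))
            (EntropicMeasure.partitionMeasure β (EntropicMeasure.Partition.std N))) < ε) ∧
      Tendsto (fun N : ℕ => EntropicMeasure.wassersteinDist
        (Measure.map (EntropicMeasure.stepMap (EntropicMeasure.Partition.std N))
          (EntropicMeasure.partitionMeasure β (EntropicMeasure.Partition.std N)))
        (Q : Measure EntropicMeasure.G0)) atTop (𝓝 0) ∧
      EntropicMeasure.MeasuredGHConverges
        (X := fun N => EntropicMeasure.PartitionSpace (EntropicMeasure.Partition.std N))
        (fun N => EntropicMeasure.partitionMeasure β (EntropicMeasure.Partition.std N))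
        (Q : Measure EntropicMeasure.G0) := by
  have hprob := EntropicMeasure.isProbabilityMeasure_entropicMeasure hβ
  have hQ := EntropicMeasure.hasDirichletMarginals_entropicMeasure hβ
  have hweak := EntropicMeasure.tendsto_integral_stepMap hβ hQ
  have herr := EntropicMeasure.tendsto_stdError
  refine ⟨fun N T => EntropicMeasure.isProbabilityMeasure_partitionMeasure hβ T,
    ⟨EntropicMeasure.entropicMeasure β, hprob⟩, hQ, fun Q' hQ' => ?_,
    fun ε hε => ?_, ?_, ?_⟩
  · have := Q'.2
    exact Subtype.ext (EntropicMeasure.HasDirichletMarginals.unique hβ hQ' hQ)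
  · have h2 : Tendsto (fun p : ℕ × ℕ => ENNReal.ofReal
        (EntropicMeasure.stdError p.1 + EntropicMeasure.stdError p.2)) atTop (𝓝 0) := by
      rw [← prod_atTop_atTop_eq]
      simpa using ENNReal.tendsto_ofReal
        ((herr.comp tendsto_fst).add (herr.comp tendsto_snd))
    obtain ⟨⟨m, n⟩, hmn⟩ := eventually_atTop.1 (h2.eventually (gt_mem_nhds hε))
    refine ⟨max m n, fun M N hM hN => (EntropicMeasure.wassersteinDist_stepMap_stepMap_le hβ hQ
      M N).trans_lt (hmn (M, N) ⟨(le_max_left m n).trans hM, (le_max_right m n).trans hN⟩)⟩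
  · refine tendsto_of_tendsto_of_tendsto_of_le_of_le tendsto_const_nhds
      (by simpa using ENNReal.tendsto_ofReal herr) (fun _ => zero_le)
      fun N => EntropicMeasure.wassersteinDist_stepMap_le hβ hQ N
  · exact ⟨fun N => 2 * EntropicMeasure.stdError N, fun N => EntropicMeasure.stepMap _,
      fun N => mul_pos two_pos (EntropicMeasure.stdError_pos N), by simpa using herr.const_mul 2,
      fun N => EntropicMeasure.measurable_stepMap _,
      EntropicMeasure.isEpsIsometry_stepMap_std,
      hweak⟩
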